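/- **Model.** A base station has $N_T$ transmit and $N_R\ge 1$ receive antennas, $N_{RF,T}$ transmit and $N_{RF,R}$ receive RF chains with $N_{RF,R}\mid N_R$, and uses $K$ sub-carriers and $L$ symbol intervals. On sub-carrier $k$ it sends $x_{k,l}=V_{RF}V_{BB,k}s_{k,l}$ with an analog beamformer $V_{RF}\in\mathbb C^{N_T\times N_{RF,T}}$ common to all sub-carriers (arbitrary; in particular one with unit-modulus entries), digital beamformers $V_{BB,k}\in\mathbb C^{N_{RF,T}\times N_{S,k}}$, $R_{BB,k}=V_{BB,k}V_{BB,k}^H$, and known data symbols $S_k=[s_{k,1},\dots,s_{k,L}]$, $\bar S=[S_1^T,\dots,S_K^T]^T$. The common receive analog beamformer $W_{RF}^H\in\mathbb C^{N_{RF,R}\times N_R}$ is partially connected: $|[W_{RF}^H]_{i,j}|=1$ if $(i-1)\frac{N_R}{N_{RF,R}}+1\le j\le i\frac{N_R}{N_{RF,R}}$, and $0$ otherwise. With differentiable steering vectors $a(\theta)\in\mathbb C^{N_T}$, $b(\theta)\in\mathbb C^{N_R}$, $M(\theta)=b(\theta)a(\theta)^H$, $\dot M=dM/d\theta$, the vectorized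 beamformed echo is $\bar y\sim\mathcal{CN}(\bar u,\bar C_y)$, where $\alpha=\alpha_R+j\alpha_I$, $$\bar u=\alpha\,\mathrm{vec}\big(\mathrm{blkdiag}(W_{RF}^HM(\theta),\dots,W_{RF}^HM(\theta))\,\mathrm{blkdiag}(V_{RF},\dots,V_{RF})\,\mathrm{blkdiag}(V_{BB,1},\dots,V_{BB,K})\,\bar S\big),$$ $\bar C_y=\bar\sigma_S^2BB^H$, $B=I_L\otimes\mathrm{blkdiag}(W_{RF}^H,\dots,W_{RF}^H)$, $\bar\sigma_S^2>0$. **Prior.** $\zeta=(\theta,\alpha_R,\alpha_I)$ has density $p_Z=p_\Theta(\theta)\,p_\alpha(\alpha_R,\alpha_I)$, where $p_\Theta$ on $\mathbb R$ and $p_\alpha$ on $\mathbb R^2$ are differentiable probability densities with finite Fisher information, $\mathbb E[\alpha_R]=\mathbb E[\alpha_I]=0$, $\gamma=\mathbb E[\alpha_R^2+\alpha_I^2]<\infty$, and the entries of $M(\theta)$ and $\dot M(\theta)$ are square integrable under $p_\Theta$. Put $$A_1=\int\dot M^HW_{RF}W_{RF}^H\dot M\,p_\Theta\,d\theta,\qquad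 A_2=\int M^HW_{RF}W_{RF}^HM\,p_\Theta\,d\theta.$$ **Information matrices.** $F_O=\mathbb E_{\bar y,\zeta}\big[\tfrac{\partial\ln p(\bar y|\zeta)}{\partial\zeta}\big(\tfrac{\partial\ln p(\bar y|\zeta)}{\partial\zeta}\big)^T\big]$, $F_P=\mathbb E_\zeta\big[\tfrac{\partial\ln p_Z}{\partial\zeta}\big(\tfrac{\partial\ln p_Z}{\partial\zeta}\big)^T\big]$, $F=F_O+F_P$, and $\mathrm{PCRB}_\theta=[F^{-1}]_{1,1}$. Write $F_O=\begin{bmatrix}\bar J_{\theta\theta}&\bar J_{\theta\alpha}\\ \bar J_{\theta\alpha}^H&\bar J_{\alpha\alpha}\end{bmatrix}$. **Claim.** 1. For every $L$ and all data symbols, all expectations in $F_O$ and $F_P$ exist, $[F_O]_{i,j}=2\,\mathbb E_\zeta\big[\Re\{(\partial\bar u/\partial\zeta_i)^H\bar C_y^{-1}\,\partial\bar u/\partial\zeta_j\}\big]$, the cross term vanishes, $\bar J_{\theta\alpha}=0$, and $F$ is invertible. 2. If the sample covariance matrices equal the transmit covariance matrices, $\frac1L\sum_{l=1}^Lx_{k,l}x_{k,l}^H=V_{RF}R_{BB,k}V_{RF}^H$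 for all $k$, then $$\bar J_{\theta\theta}=\frac{2N_{RF,R}L\gamma}{N_R\bar\sigma_S^2}\sum_{k=1}^K\mathrm{tr}(A_1V_{RF}R_{BB,k}V_{RF}^H),\qquad \bar J_{\alpha\alpha}=\frac{2N_{RF,R}L}{N_R\bar\sigma_S^2}\sum_{k=1}^K\mathrm{tr}(A_2V_{RF}R_{BB,k}V_{RF}^H)\,I_2,$$ $$\mathrm{PCRB}_\theta=\frac{1}{\mathbb E_\theta\Big[\Big(\frac{\partial\ln p_\Theta(\theta)}{\partial\theta}\Big)^2\Big]+\frac{2N_{RF,R}L\gamma}{N_R\bar\sigma_S^2}\sum_{k=1}^K\mathrm{tr}(A_1V_{RF}R_{BB,k}V_{RF}^H)}.$$ 3. If, on each sub-carrier $k$, the data symbols $s_{k,1},s_{k,2},\dots$ are independent with law $\mathcal{CN}(0,I_{N_{S,k}})$, then almost surely the ratio of $\mathrm{PCRB}_\theta$, computed for the first $L$ symbol intervals, to the right-hand side of the last display tends to $1$ as $L\to\infty$. -/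

import Mathlib

open MeasureTheory ProbabilityTheory Filter Topology
open scoped Matrix Kronecker

noncomputable section

/-- The density, with respect to Lebesgue measure on `ℂ^ι`, of the circularly symmetric complex
Gaussian law with mean `u` and (positive definite) covariance matrix `C`:
`π^{-n} (det C)⁻¹ exp(-(y-u)ᴴ C⁻¹ (y-u))`. -/
def cnPDF {ι : Type*} [Fintype ι] [DecidableEq ι] (u : ι → ℂ) (C : Matrix ι ι ℂ) (y : ι → ℂ) : ℝ :=
  (Real.pi ^ Fintype.card ι)⁻¹ * (C.det.re)⁻¹ *
    Real.exp (-(star (y - u) ⬝ᵥ (C⁻¹ *ᵥ (y - u))).re)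

/-- The law `CN(u, C)`. -/
def cnMeasure {ι : Type*} [Fintype ι] [DecidableEq ι] (u : ι → ℂ) (C : Matrix ι ι ℂ) :
    Measure (ι → ℂ) :=
  volume.withDensity fun y => ENNReal.ofReal (cnPDF u C y)

/-- The unit directions of the three real parameters `(θ, α_R, α_I)`. -/
def paramDir : Fin 3 → ℝ × ℝ × ℝ := ![(1, 0, 0), (0, 1, 0), (0, 0, 1)]

/-- The unit directions of the two real parameters `(α_R, α_I)`. -/
def alphaDir : Fin 2 → ℝ × ℝ := ![(1, 0), (0, 1)]

/-- `[∂f/∂ζ]_i` at `ζ = (θ, α_R, α_I)`. -/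
def paramDeriv {E : Type*} [NormedAddCommGroup E] [NormedSpace ℝ E]
    (f : ℝ × ℝ × ℝ → E) (i : Fin 3) (ζ : ℝ × ℝ × ℝ) : E :=
  lineDeriv ℝ f ζ (paramDir i)

/-- The receive analog beamformer `Wᴴ` is partially connected: row `i` (counted from `0`) has
unit-modulus entries in the columns `i Q, …, (i + 1) Q - 1`, with `Q = NR / nR`, and zeros
elsewhere. -/
def IsPartiallyConnected {NR nR : ℕ} (W : Matrix (Fin NR) (Fin nR) ℂ) : Prop :=
  ∀ (i : Fin nR) (j : Fin NR),
    ‖Wᴴ i j‖ =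
      if (i : ℕ) * (NR / nR) ≤ (j : ℕ) ∧ (j : ℕ) < ((i : ℕ) + 1) * (NR / nR) then 1 else 0

/-- The data of a MIMO-OFDM sensing system with `NT` transmit and `NR` receive antennas, `nT`
transmit and `nR` receive RF chains, `K` sub-carriers, and `Ns k` data streams on sub-carrier
`k`. -/
structure MIMOOFDM (NT NR nT nR K : ℕ) (Ns : Fin K → ℕ) where
  /-- transmit steering vector -/
  a : ℝ → Fin NT → ℂ
  /-- receive steering vector -/
  b : ℝ → Fin NR → ℂ
  /-- receive analog beamformer `W_RF` (common to all sub-carriers) -/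
  W : Matrix (Fin NR) (Fin nR) ℂ
  /-- transmit analog beamformer `V_RF` (common to all sub-carriers) -/
  VRF : Matrix (Fin NT) (Fin nT) ℂ
  /-- transmit digital beamformers `V_BB,k` -/
  VBB : (k : Fin K) → Matrix (Fin nT) (Fin (Ns k)) ℂ
  /-- noise power at each receive antenna and sub-carrier -/
  noiseVar : ℝ
  /-- prior density of the angle -/
  pΘ : ℝ → ℝ
  /-- prior density of `(α_R, α_I)` -/
  pα : ℝ × ℝ → ℝ

namespace MIMOOFDM

variable {NT NR nT nR K : ℕ} {Ns : Fin K → ℕ}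

/-- `M(θ) = b(θ) a(θ)ᴴ`. -/
def M (sys : MIMOOFDM NT NR nT nR K Ns) (θ : ℝ) : Matrix (Fin NR) (Fin NT) ℂ :=
  Matrix.vecMulVec (sys.b θ) (star (sys.a θ))

/-- The entrywise derivative of `M`. -/
def Mdot (sys : MIMOOFDM NT NR nT nR K Ns) (θ : ℝ) : Matrix (Fin NR) (Fin NT) ℂ :=
  Matrix.of fun i j => deriv (fun t => sys.M t i j) θ

/-- `R_BB,k = V_BB,k V_BB,kᴴ`. -/
def RBB (sys : MIMOOFDM NT NR nT nR K Ns) (k : Fin K) : Matrix (Fin nT) (Fin nT) ℂ :=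
  sys.VBB k * (sys.VBB k)ᴴ

/-- The transmit covariance matrix `V_RF R_BB,k V_RFᴴ` of sub-carrier `k`. -/
def txCov (sys : MIMOOFDM NT NR nT nR K Ns) (k : Fin K) : Matrix (Fin NT) (Fin NT) ℂ :=
  sys.VRF * sys.RBB k * sys.VRFᴴ

/-- The transmit sample covariance matrix `(1/L) ∑_l x_{k,l} x_{k,l}ᴴ` of sub-carrier `k`, where
`x_{k,l} = V_RF V_BB,k s_{k,l}` and `s_{k,l}` is the `l`-th column of `S k`. -/
def sampleCov (sys : MIMOOFDM NT NR nT nR K Ns) {L : ℕ}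
    (S : (k : Fin K) → Matrix (Fin (Ns k)) (Fin L) ℂ) (k : Fin K) :
    Matrix (Fin NT) (Fin NT) ℂ :=
  (1 / (L : ℂ)) • ∑ l : Fin L,
    Matrix.vecMulVec ((sys.VRF * sys.VBB k) *ᵥ fun i => S k i l)
      (star ((sys.VRF * sys.VBB k) *ᵥ fun i => S k i l))

/-- `A_1 = ∫ Ṁᴴ W Wᴴ Ṁ p_Θ dθ`. -/
def A₁ (sys : MIMOOFDM NT NR nT nR K Ns) : Matrix (Fin NT) (Fin NT) ℂ :=
  Matrix.of fun i j =>
    ∫ θ, ((sys.Mdot θ)ᴴ * sys.W * sys.Wᴴ * sys.Mdot θ) i j * (sys.pΘ θ : ℂ)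

/-- `A_2 = ∫ Mᴴ W Wᴴ M p_Θ dθ`. -/
def A₂ (sys : MIMOOFDM NT NR nT nR K Ns) : Matrix (Fin NT) (Fin NT) ℂ :=
  Matrix.of fun i j =>
    ∫ θ, ((sys.M θ)ᴴ * sys.W * sys.Wᴴ * sys.M θ) i j * (sys.pΘ θ : ℂ)

/-- `γ = E[α_R² + α_I²]`. -/
def γ (sys : MIMOOFDM NT NR nT nR K Ns) : ℝ :=
  ∫ x : ℝ × ℝ, (x.1 ^ 2 + x.2 ^ 2) * sys.pα x

/-- The prior Fisher information `E[(∂ ln p_Θ / ∂θ)²]` of the angle. -/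
def priorInfoΘ (sys : MIMOOFDM NT NR nT nR K Ns) : ℝ :=
  ∫ θ, (deriv (fun t => Real.log (sys.pΘ t)) θ) ^ 2 * sys.pΘ θ

/-- The prior density `p_Z(ζ) = p_Θ(θ) p_α(α_R, α_I)` of `ζ = (θ, α_R, α_I)`. -/
def pZ (sys : MIMOOFDM NT NR nT nR K Ns) (ζ : ℝ × ℝ × ℝ) : ℝ :=
  sys.pΘ ζ.1 * sys.pα ζ.2

/-- The data symbols of all sub-carriers, `[S_1ᵀ, …, S_Kᵀ]ᵀ`. -/
def stack {L : ℕ} (S : (k : Fin K) → Matrix (Fin (Ns k)) (Fin L) ℂ) :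
    Matrix (Σ k : Fin K, Fin (Ns k)) (Fin L) ℂ :=
  Matrix.of fun p l => S p.1 p.2 l

/-- The noise-free vectorized received signal
`ū = α vec(blkdiag(Wᴴ b aᴴ, …, Wᴴ b aᴴ) blkdiag(V_RF, …, V_RF) blkdiag(V_BB,1, …, V_BB,K) S̄)`,
with `α = α_R + j α_I`. -/
def obsMean (sys : MIMOOFDM NT NR nT nR K Ns) {L : ℕ}
    (S : (k : Fin K) → Matrix (Fin (Ns k)) (Fin L) ℂ) (ζ : ℝ × ℝ × ℝ) :
    Fin L × (Σ _ : Fin K, Fin nR) → ℂ :=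
  ((ζ.2.1 : ℂ) + (ζ.2.2 : ℂ) * Complex.I) •
    Matrix.vec (Matrix.blockDiagonal' (fun _ : Fin K => sys.Wᴴ * sys.M ζ.1) *
      Matrix.blockDiagonal' (fun _ : Fin K => sys.VRF) *
      Matrix.blockDiagonal' sys.VBB * stack S)

/-- The covariance matrix of the vectorized effective noise `vec(blkdiag(Wᴴ, …, Wᴴ) N̄)`, where
the entries of `N̄` are independent `CN(0, noiseVar)` variables. -/
def obsCov (sys : MIMOOFDM NT NR nT nR K Ns) (L : ℕ) :
    Matrix (Fin L × (Σ _ : Fin K, Fin nR)) (Fin L × (Σ _ : Fin K, Fin nR)) ℂ :=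
  (sys.noiseVar : ℂ) •
    (((1 : Matrix (Fin L) (Fin L) ℂ) ⊗ₖ Matrix.blockDiagonal' fun _ : Fin K => sys.Wᴴ) *
      ((1 : Matrix (Fin L) (Fin L) ℂ) ⊗ₖ Matrix.blockDiagonal' fun _ : Fin K => sys.Wᴴ)ᴴ)

/-- The likelihood `p(ȳ | ζ)`: the density of `CN(ū(ζ), C̄_y)`. -/
def likelihood (sys : MIMOOFDM NT NR nT nR K Ns) {L : ℕ}
    (S : (k : Fin K) → Matrix (Fin (Ns k)) (Fin L) ℂ) (ζ : ℝ × ℝ × ℝ)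
    (y : Fin L × (Σ _ : Fin K, Fin nR) → ℂ) : ℝ :=
  cnPDF (sys.obsMean S ζ) (sys.obsCov L) y

/-- The function of `(ζ, ȳ)` whose integral is the `(i, j)` entry of the observation PFIM: the
product of two components of the score `∂ ln p(ȳ | ζ) / ∂ζ` times the joint density
`p(ȳ | ζ) p_Z(ζ)`. -/
def obsIntegrand (sys : MIMOOFDM NT NR nT nR K Ns) {L : ℕ}
    (S : (k : Fin K) → Matrix (Fin (Ns k)) (Fin L) ℂ) (i j : Fin 3)
    (x : (ℝ × ℝ × ℝ) × (Fin L × (Σ _ : Fin K, Fin nR) → ℂ)) : ℝ :=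
  paramDeriv (fun ζ => Real.log (sys.likelihood S ζ x.2)) i x.1 *
    paramDeriv (fun ζ => Real.log (sys.likelihood S ζ x.2)) j x.1 *
    (sys.likelihood S x.1 x.2 * sys.pZ x.1)

/-- The PFIM `F_O` from the observation, for the transmitted data symbols `S`. -/
def FO (sys : MIMOOFDM NT NR nT nR K Ns) {L : ℕ}
    (S : (k : Fin K) → Matrix (Fin (Ns k)) (Fin L) ℂ) : Matrix (Fin 3) (Fin 3) ℝ :=
  Matrix.of fun i j => ∫ x, sys.obsIntegrand S i j x

/-- The function of `ζ` whose integral is the `(i, j)` entry of the prior PFIM. -/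
def priorIntegrand (sys : MIMOOFDM NT NR nT nR K Ns) (i j : Fin 3) (ζ : ℝ × ℝ × ℝ) : ℝ :=
  paramDeriv (fun ξ => Real.log (sys.pZ ξ)) i ζ *
    paramDeriv (fun ξ => Real.log (sys.pZ ξ)) j ζ * sys.pZ ζ

/-- The PFIM `F_P` from the prior. -/
def FP (sys : MIMOOFDM NT NR nT nR K Ns) : Matrix (Fin 3) (Fin 3) ℝ :=
  Matrix.of fun i j => ∫ ζ, sys.priorIntegrand i j ζ

/-- The overall PFIM `F = F_O + F_P`. -/
def PFIM (sys : MIMOOFDM NT NR nT nR K Ns) {L : ℕ}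
    (S : (k : Fin K) → Matrix (Fin (Ns k)) (Fin L) ℂ) : Matrix (Fin 3) (Fin 3) ℝ :=
  sys.FO S + sys.FP

/-- The PCRB for `θ`: the first diagonal entry of `F⁻¹`. -/
def PCRB (sys : MIMOOFDM NT NR nT nR K Ns) {L : ℕ}
    (S : (k : Fin K) → Matrix (Fin (Ns k)) (Fin L) ℂ) : ℝ :=
  (sys.PFIM S)⁻¹ 0 0

/-- The block of data symbols of the first `L` symbol intervals. -/
def symbolBlock (s : (k : Fin K) → ℕ → Fin (Ns k) → ℂ) (L : ℕ) (k : Fin K) :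
    Matrix (Fin (Ns k)) (Fin L) ℂ :=
  Matrix.of fun i l => s k l i

end MIMOOFDM

end

/-! Partial connection gives the rows of `Wᴴ` disjoint supports, each with `NR / nR` unit-modulus
entries, so `Wᴴ W = (NR / nR) I` (`conjTranspose_W_mul_W`). Receive beamforming therefore keeps the
noise white, and the likelihood is a product of scalar circular Gaussians of precision `c = nR / (NR
σ²)`. Its score is `2c Re(∂ūᴴ n)`, linear in the noise `n = y - ū`. The shear `(ζ, y) ↦ (ζ, y -
ū(ζ))` preserves Lebesgue measure, and circular symmetry gives `E[Re(vᴴn) Re(wᴴn)] = Re(vᴴw) / (2c)`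
(`integral_re_mul_re_cgPi`). Hence `F_O = 2c E[Re(∂ᵢūᴴ ∂ⱼū)]` (`FO_eq`).

The `θ`-derivative of `ū` is linear in `α`, while the `α`-derivatives do not involve `α`. Zero mean
of `α` thus kills the cross term, and the diagonal blocks are mean echo energies, which equal `L ∑
tr(A · sampleCov)` (`echoEnergy_eq`).

In the prior information the cross term contains the factor `∫ pΘ' = 0`, and both diagonal blocks
are positive definite: a density on the line is not constant, and a density on the plane with finite
first moments is not constant along a direction (`fisher_pos`, `planeFisher_pos`). So `F` is block
diagonal and invertible for all symbols, and the PCRB is the reciprocal of its first entry.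

For random symbols the strong law sends the sample covariances to the transmit covariances. The
ratio of two reciprocals of affine functions of `L` then tends to 1, except possibly when the
limiting slope is 0. There positivity of `A₁` makes the slope vanish for every choice of symbols,
and the ratio is exactly 1. -/

noncomputable section

/-! ### Moments of white circular complex Gaussian vectors. -/

/-- The density of `CN(0, c⁻¹)` on `ℂ`. -/
def cgDensity (c : ℝ) (z : ℂ) : ℝ := c / Real.pi * Real.exp (-c * ‖z‖ ^ 2)

/-- The density of `CN(0, c⁻¹ I)` on `ℂ^ι`. -/
def cgPi {ι : Type*} [Fintype ι] (c : ℝ) (y : ι → ℂ) : ℝ := ∏ p, cgDensity c (y p)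

lemma cgDensity_nonneg {c : ℝ} (hc : 0 < c) (z : ℂ) : 0 ≤ cgDensity c z := by
  unfold cgDensity; positivity

lemma cgDensity_neg (c : ℝ) (z : ℂ) : cgDensity c (-z) = cgDensity c z := by
  simp [cgDensity]

lemma continuous_cgDensity (c : ℝ) : Continuous (cgDensity c) := by
  unfold cgDensity; fun_prop

lemma integral_cgDensity {c : ℝ} (hc : 0 < c) : ∫ z, cgDensity c z = 1 := by
  have h := Complex.integral_rpow_mul_exp_neg_mul_rpow (p := 2) (q := 0) (b := c)
    (by norm_num) (by norm_num) hc
  have e : (-(0 + 2) / 2 : ℝ) = -1 := by norm_num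
  have e' : ((0 + 2) / 2 : ℝ) = 1 := by norm_num
  rw [e, e', Real.Gamma_one, Real.rpow_neg_one] at h
  simp only [Real.rpow_zero, one_mul, Real.rpow_two] at h
  simp only [cgDensity, integral_const_mul, h]
  field_simp

lemma integral_sq_mul_cgDensity {c : ℝ} (hc : 0 < c) :
    ∫ z, ‖z‖ ^ 2 * cgDensity c z = 1 / c := by
  have h := Complex.integral_rpow_mul_exp_neg_mul_rpow (p := 2) (q := 2) (b := c)
    (by norm_num) (by norm_num) hc
  have e : (-(2 + 2) / 2 : ℝ) = -2 := by norm_num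
  have e' : ((2 + 2) / 2 : ℝ) = 2 := by norm_num
  rw [e, e', Real.Gamma_two, Real.rpow_neg hc.le] at h
  simp only [Real.rpow_two] at h
  calc ∫ z, ‖z‖ ^ 2 * cgDensity c z
      = ∫ z : ℂ, c / Real.pi * (‖z‖ ^ 2 * Real.exp (-c * ‖z‖ ^ 2)) := by
        congr 1; ext z; simp only [cgDensity]; ring
    _ = 1 / c := by rw [integral_const_mul, h]; field_simp

lemma integrable_cgDensity {c : ℝ} (hc : 0 < c) : Integrable (cgDensity c) :=
  -- The integral of a non-integrable function is 0 by convention, so a nonzero value proves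
  -- integrability.
  Integrable.of_integral_ne_zero (by rw [integral_cgDensity hc]; norm_num)

lemma integrable_sq_mul_cgDensity {c : ℝ} (hc : 0 < c) :
    Integrable fun z => ‖z‖ ^ 2 * cgDensity c z :=
  Integrable.of_integral_ne_zero (by rw [integral_sq_mul_cgDensity hc]; positivity)

/-- A continuous function dominated by `1 + ‖z‖²` is integrable against the Gaussian density. -/
lemma integrable_cgDensity_mul {c : ℝ} (hc : 0 < c) {g : ℂ → ℂ} (hg : Continuous g)
    (hb : ∀ z, ‖g z‖ ≤ 1 + ‖z‖ ^ 2) : Integrable fun z => (cgDensity c z : ℂ) * g z := by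
  refine ((integrable_cgDensity hc).add (integrable_sq_mul_cgDensity hc)).mono' ?_ ?_
  · exact ((Complex.continuous_ofReal.comp (continuous_cgDensity c)).mul hg).aestronglyMeasurable
  · refine Eventually.of_forall fun z => ?_
    have := cgDensity_nonneg hc z
    simp only [norm_mul, Complex.norm_real, Real.norm_of_nonneg this, Pi.add_apply]
    nlinarith [mul_le_mul_of_nonneg_left (hb z) this]

lemma integral_cgDensity_mul_self (c : ℝ) : ∫ z, (cgDensity c z : ℂ) * z = 0 := by
  have h := integral_neg_eq_self (fun z : ℂ => (cgDensity c z : ℂ) * z) volume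
  simp only [cgDensity_neg, mul_neg, integral_neg] at h
  exact self_eq_neg.1 h.symm

/-- Rotation by `I` preserves the measure and the density but changes the sign of `z²`. -/
lemma integral_cgDensity_mul_sq (c : ℝ) : ∫ z, (cgDensity c z : ℂ) * (z * z) = 0 := by
  obtain ⟨w, hw⟩ : ∃ w : Circle, (w : ℂ) = Complex.I :=
    ⟨Circle.exp (Real.pi / 2), by simp [Circle.coe_exp, Complex.exp_pi_div_two_mul_I]⟩
  have h := (rotation w).measurePreserving.integral_comp
    (rotation w).toHomeomorph.measurableEmbedding (fun z : ℂ => (cgDensity c z : ℂ) * (z * z))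
  have e : ∀ z : ℂ, (cgDensity c (rotation w z) : ℂ) * (rotation w z * rotation w z) =
      -((cgDensity c z : ℂ) * (z * z)) := by
    intro z
    have h2 : cgDensity c (rotation w z) = cgDensity c z := by
      rw [cgDensity, cgDensity, LinearIsometryEquiv.norm_map]
    rw [h2, rotation_apply, hw]
    linear_combination (cgDensity c z : ℂ) * z ^ 2 * Complex.I_sq
  simp only [e, integral_neg] at h
  exact self_eq_neg.1 h.symm

lemma integral_cgDensity_mul_conj {c : ℝ} (hc : 0 < c) :
    ∫ z, (cgDensity c z : ℂ) * (z * star z) = 1 / c := by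
  have : ∀ z : ℂ, (cgDensity c z : ℂ) * (z * star z) = ((‖z‖ ^ 2 * cgDensity c z : ℝ) : ℂ) := by
    intro z
    rw [Complex.star_def, Complex.mul_conj, Complex.normSq_eq_norm_sq]; push_cast; ring
  simp only [this]
  rw [integral_complex_ofReal, integral_sq_mul_cgDensity hc]; push_cast; rfl

section Pi
variable {ι : Type*} [Fintype ι]

lemma cgPi_nonneg {c : ℝ} (hc : 0 < c) (y : ι → ℂ) : 0 ≤ cgPi c y :=
  Finset.prod_nonneg fun _ _ => cgDensity_nonneg hc _

lemma continuous_cgPi (c : ℝ) : Continuous (cgPi c : (ι → ℂ) → ℝ) :=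
  continuous_finsetProd _ fun p _ => (continuous_cgDensity c).comp (continuous_apply p)

/-- The real part of a Hermitian product is controlled by the energies of its factors. -/
lemma re_star_dotProduct_sq_le (v y : ι → ℂ) :
    (star v ⬝ᵥ y).re ^ 2 ≤ (∑ p, ‖v p‖ ^ 2) * ∑ p, ‖y p‖ ^ 2 := by
  have h1 : |(star v ⬝ᵥ y).re| ≤ ∑ p, ‖v p‖ * ‖y p‖ := by
    refine (Complex.abs_re_le_norm _).trans ((norm_sum_le _ _).trans_eq ?_)
    simp
  calc (star v ⬝ᵥ y).re ^ 2 = |(star v ⬝ᵥ y).re| ^ 2 := (sq_abs _).symm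
    _ ≤ (∑ p, ‖v p‖ * ‖y p‖) ^ 2 := by gcongr
    _ ≤ _ := Finset.sum_mul_sq_le_sq_mul_sq _ _ _

variable [DecidableEq ι]

/-- Padding with factors 1 turns the integrand into a product over coordinates, ready for Fubini.
The case `i = j` is included, since both indicators then select the same coordinate. -/
lemma cgPi_mul_eq_prod (c : ℝ) (g h : ℂ → ℂ) (i j : ι) (y : ι → ℂ) :
    (cgPi c y : ℂ) * (g (y i) * h (y j)) =
      ∏ p, (cgDensity c (y p) : ℂ) *
        ((if p = i then g (y p) else 1) * (if p = j then h (y p) else 1)) := by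
  simp only [Finset.prod_mul_distrib, cgPi, Complex.ofReal_prod, Finset.prod_ite_eq',
    Finset.mem_univ, if_true]

lemma integrable_cgPi_mul {c : ℝ} (hc : 0 < c) {g h : ℂ → ℂ} (hg : Continuous g)
    (hh : Continuous h) (hgb : ∀ z, ‖g z‖ ≤ ‖z‖) (hhb : ∀ z, ‖h z‖ ≤ ‖z‖) (i j : ι) :
    Integrable fun y : ι → ℂ => (cgPi c y : ℂ) * (g (y i) * h (y j)) := by
  simp only [cgPi_mul_eq_prod]
  refine Integrable.fintype_prod (f := fun p z => (cgDensity c z : ℂ) *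
        ((if p = i then g z else 1) * (if p = j then h z else 1))) fun p => ?_
  refine integrable_cgDensity_mul hc ?_ fun z => ?_
  · split_ifs <;> fun_prop
  · have h1 := hgb z
    have h2 := hhb z
    have h3 := norm_nonneg z
    split_ifs
    · rw [norm_mul]
      nlinarith [mul_le_mul h1 h2 (norm_nonneg _) h3]
    · simp only [mul_one]; nlinarith [sq_nonneg (‖z‖ - 1)]
    · simp only [one_mul]; nlinarith [sq_nonneg (‖z‖ - 1)]
    · simp

lemma integral_cgPi_mul {c : ℝ} (hc : 0 < c) {g h : ℂ → ℂ}
    (hg0 : ∫ z, (cgDensity c z : ℂ) * g z = 0) (i j : ι) :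
    ∫ y : ι → ℂ, (cgPi c y : ℂ) * (g (y i) * h (y j)) =
      if i = j then ∫ z, (cgDensity c z : ℂ) * (g z * h z) else 0 := by
  simp only [cgPi_mul_eq_prod]
  rw [integral_fintype_prod_volume_eq_prod (fun p z => (cgDensity c z : ℂ) *
        ((if p = i then g z else 1) * (if p = j then h z else 1)))]
  split_ifs with hij
  · subst hij
    rw [← Finset.prod_erase_mul _ _ (Finset.mem_univ i), Finset.prod_eq_one, one_mul]
    · simp
    · intro p hp
      simp only [if_neg (Finset.ne_of_mem_erase hp), mul_one]
      rw [integral_complex_ofReal, integral_cgDensity hc]; simp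
  · refine Finset.prod_eq_zero (Finset.mem_univ i) ?_
    simp [if_neg hij, hg0]

lemma integrable_cgPi_mul_conj {c : ℝ} (hc : 0 < c) (i j : ι) :
    Integrable fun y : ι → ℂ => (cgPi c y : ℂ) * (y i * star (y j)) :=
  integrable_cgPi_mul hc continuous_id continuous_star (by simp) (by simp) i j

lemma integral_cgPi_mul_conj {c : ℝ} (hc : 0 < c) (i j : ι) :
    ∫ y : ι → ℂ, (cgPi c y : ℂ) * (y i * star (y j)) = if i = j then 1 / (c : ℂ) else 0 := by
  rw [← integral_cgDensity_mul_conj hc]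
  exact integral_cgPi_mul (g := id) hc (integral_cgDensity_mul_self c) i j

/-- The covariance of two real linear functionals of a circularly symmetric Gaussian vector. -/
lemma integral_re_mul_re_cgPi {c : ℝ} (hc : 0 < c) (v w : ι → ℂ) :
    ∫ y : ι → ℂ, (star v ⬝ᵥ y).re * (star w ⬝ᵥ y).re * cgPi c y =
      (star v ⬝ᵥ w).re / (2 * c) := by
  have i1 : ∀ i j : ι, Integrable fun y : ι → ℂ => (cgPi c y : ℂ) * (y i * y j) :=
    integrable_cgPi_mul hc continuous_id continuous_id (by simp) (by simp)
  have e1 : ∀ i j : ι, ∫ y : ι → ℂ, (cgPi c y : ℂ) * (y i * y j) = 0 := by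
    intro i j
    have := integral_cgPi_mul (g := id) (h := id) hc (integral_cgDensity_mul_self c) i j
    simp only [id, integral_cgDensity_mul_sq, ite_self] at this
    exact this
  -- `Re a · Re b = Re (a (b + b̄)) / 2` splits the product into a pseudo-covariance part in `yᵢ
  -- yⱼ`, which integrates to 0, and a covariance part in `yᵢ ȳⱼ`. The half is the source of the 2
  -- in `2 * c`.
  have key : ∀ y : ι → ℂ, (star v ⬝ᵥ y).re * (star w ⬝ᵥ y).re * cgPi c y =
      (∑ i, ∑ j, (star (v i) * star (w j) / 2 * ((cgPi c y : ℂ) * (y i * y j)) +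
        star (v i) * w j / 2 * ((cgPi c y : ℂ) * (y i * star (y j))))).re := by
    intro y
    have h1 : (∑ i, ∑ j, (star (v i) * star (w j) / 2 * ((cgPi c y : ℂ) * (y i * y j)) +
        star (v i) * w j / 2 * ((cgPi c y : ℂ) * (y i * star (y j))))) =
        (((cgPi c y / 2 : ℝ) : ℂ)) * ((star v ⬝ᵥ y) * ((star w ⬝ᵥ y) + star (star w ⬝ᵥ y))) := by
      simp only [dotProduct, star_sum, ← Finset.sum_add_distrib]
      rw [Finset.sum_mul_sum, Finset.mul_sum]
      simp only [Finset.mul_sum]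
      refine Finset.sum_congr rfl fun i _ => Finset.sum_congr rfl fun j _ => ?_
      simp only [Pi.star_apply, star_mul', star_star]; push_cast; ring
    rw [h1, Complex.re_ofReal_mul]
    have h2 : (star w ⬝ᵥ y) + star (star w ⬝ᵥ y) = ((2 * (star w ⬝ᵥ y).re : ℝ) : ℂ) := by
      rw [Complex.star_def, Complex.add_conj]
    rw [h2, mul_comm (star v ⬝ᵥ y), Complex.re_ofReal_mul]; ring
  have hint : ∀ i j : ι, Integrable fun y : ι → ℂ =>
      (star (v i) * star (w j) / 2 * ((cgPi c y : ℂ) * (y i * y j)) +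
        star (v i) * w j / 2 * ((cgPi c y : ℂ) * (y i * star (y j)))) := fun i j =>
    ((i1 i j).const_mul _).add ((integrable_cgPi_mul_conj hc i j).const_mul _)
  simp only [key]
  have := integral_re (𝕜 := ℂ) (integrable_finsetSum Finset.univ fun i _ =>
    integrable_finsetSum Finset.univ fun j _ => hint i j)
  simp only [RCLike.re_to_complex] at this
  rw [this, integral_finsetSum _ fun i _ => integrable_finsetSum _ fun j _ => hint i j]
  have e2 : ∀ i, ∫ y : ι → ℂ, ∑ j, (star (v i) * star (w j) / 2 * ((cgPi c y : ℂ) * (y i * y j)) +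
        star (v i) * w j / 2 * ((cgPi c y : ℂ) * (y i * star (y j)))) =
        star (v i) * w i * ((1 / (2 * c) : ℝ) : ℂ) := by
    intro i
    rw [integral_finsetSum _ fun j _ => hint i j]
    simp only [integral_add ((i1 i _).const_mul _) ((integrable_cgPi_mul_conj hc i _).const_mul _),
      integral_const_mul, e1, integral_cgPi_mul_conj hc]
    simp
    field_simp
  simp only [e2, ← Finset.sum_mul]
  rw [mul_comm, Complex.re_ofReal_mul]
  simp only [dotProduct, Pi.star_apply]
  ring

lemma integrable_energy_mul_cgPi {c : ℝ} (hc : 0 < c) :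
    Integrable fun y : ι → ℂ => (∑ p, ‖y p‖ ^ 2) * cgPi c y := by
  simp only [Finset.sum_mul]
  refine integrable_finsetSum _ fun p _ => ?_
  have := (integrable_cgPi_mul_conj hc p p).norm
  refine this.congr (Eventually.of_forall fun y => ?_)
  simp [abs_of_nonneg (cgPi_nonneg hc y)]; ring

lemma cnPDF_smul_one {κ : ℝ} (hκ : 0 < κ) (u y : ι → ℂ) :
    cnPDF u ((κ : ℂ) • (1 : Matrix ι ι ℂ)) y = cgPi κ⁻¹ (y - u) := by
  have hdet : (((κ : ℂ) • (1 : Matrix ι ι ℂ)).det).re = κ ^ Fintype.card ι := by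
    rw [Matrix.det_smul, Matrix.det_one, mul_one, ← Complex.ofReal_pow, Complex.ofReal_re]
  have hinv : ((κ : ℂ) • (1 : Matrix ι ι ℂ))⁻¹ = ((κ⁻¹ : ℝ) : ℂ) • (1 : Matrix ι ι ℂ) := by
    refine Matrix.inv_eq_left_inv ?_
    rw [smul_mul_smul_comm, one_mul, ← Complex.ofReal_mul, inv_mul_cancel₀ hκ.ne']; simp
  have hq : (star (y - u) ⬝ᵥ (y - u)).re = ∑ p, ‖y p - u p‖ ^ 2 := by
    simp only [dotProduct, Pi.star_apply, Pi.sub_apply, Complex.re_sum]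
    refine Finset.sum_congr rfl fun p _ => ?_
    rw [mul_comm, Complex.star_def, Complex.mul_conj, Complex.ofReal_re, Complex.normSq_eq_norm_sq]
  simp only [cnPDF, hdet, hinv, Matrix.smul_mulVec, Matrix.one_mulVec, dotProduct_smul,
    smul_eq_mul, Complex.re_ofReal_mul, hq, cgPi, cgDensity, Finset.prod_mul_distrib,
    ← Real.exp_sum, ← Finset.mul_sum, Pi.sub_apply, Finset.prod_const, Finset.card_univ]
  rw [neg_mul, ← mul_inv, ← mul_pow, div_eq_mul_inv, ← mul_inv, inv_pow, mul_comm κ]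

end Pi

/-! ### Scores and Fisher information of differentiable densities. -/

section Score

lemma lineDeriv_log {E : Type*} [NormedAddCommGroup E] [NormedSpace ℝ E] {f : E → ℝ} {x : E}
    (hf : DifferentiableAt ℝ f x) (hx : f x ≠ 0) (v : E) :
    lineDeriv ℝ (fun y => Real.log (f y)) x v = lineDeriv ℝ f x v / f x := by
  rw [(hf.log hx).lineDeriv_eq_fderiv, hf.lineDeriv_eq_fderiv, fderiv.log hf hx]
  simp [div_eq_inv_mul]

/-- The derivative of a nonnegative differentiable function vanishes at its zeros. -/
lemma lineDeriv_eq_zero_of_nonneg {E : Type*} [NormedAddCommGroup E] [NormedSpace ℝ E]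
    {f : E → ℝ} (hf0 : ∀ x, 0 ≤ f x) {x : E} (hx : f x = 0) (v : E) :
    lineDeriv ℝ f x v = 0 := by
  have hmin : IsLocalMin f x := Eventually.of_forall fun y => hx ▸ hf0 y
  by_cases hd : DifferentiableAt ℝ (fun t : ℝ => f (x + t • v)) 0
  · refine IsLocalMin.deriv_eq_zero (f := fun t : ℝ => f (x + t • v)) ?_
    refine Eventually.of_forall fun t => ?_
    simp [hx, hf0]
  · exact deriv_zero_of_not_differentiableAt hd

/-- No positivity of `f` is needed: a zero of `f` is a minimum, so there the right side vanishes,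
while the weight `f x` removes whatever value the derivative of the logarithm takes. -/
lemma lineDeriv_log_mul {E : Type*} [NormedAddCommGroup E] [NormedSpace ℝ E]
    {f : E → ℝ} (hf : Differentiable ℝ f) (hf0 : ∀ x, 0 ≤ f x) (x v : E) :
    lineDeriv ℝ (fun y => Real.log (f y)) x v * f x = lineDeriv ℝ f x v := by
  by_cases hx : f x = 0
  · rw [hx, mul_zero, lineDeriv_eq_zero_of_nonneg hf0 hx]
  · rw [lineDeriv_log (hf x) hx, div_mul_cancel₀ _ hx]

lemma lineDeriv_one_eq_deriv (f : ℝ → ℝ) (x : ℝ) : lineDeriv ℝ f x 1 = deriv f x := by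
  simp [lineDeriv, deriv_comp_const_add]

/-- If `s² p` and `p` are integrable, then so is `s p`. -/
lemma integrable_mul_of_sq {α : Type*} [MeasurableSpace α] {μ : Measure α} {s p : α → ℝ}
    (hp0 : ∀ x, 0 ≤ p x) (hm : AEStronglyMeasurable (fun x => s x * p x) μ)
    (hs : Integrable (fun x => s x ^ 2 * p x) μ) (hp : Integrable p μ) :
    Integrable (fun x => s x * p x) μ := by
  refine (hs.add hp).mono' hm (Eventually.of_forall fun x => ?_)
  rw [Real.norm_eq_abs, abs_mul, abs_of_nonneg (hp0 x), Pi.add_apply]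
  have := hp0 x
  have h2 : |s x| ≤ s x ^ 2 + 1 := by
    rw [← sq_abs]; nlinarith [sq_nonneg (|s x| - 1)]
  nlinarith

/-- If `s² p` and `t² p` are integrable, then so is `s t p`. -/
lemma integrable_mul_mul_of_sq {α : Type*} [MeasurableSpace α] {μ : Measure α} {s t p : α → ℝ}
    (hp0 : ∀ x, 0 ≤ p x) (hm : AEStronglyMeasurable (fun x => s x * t x * p x) μ)
    (hs : Integrable (fun x => s x ^ 2 * p x) μ) (ht : Integrable (fun x => t x ^ 2 * p x) μ) :
    Integrable (fun x => s x * t x * p x) μ := by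
  refine (hs.add ht).mono' hm (Eventually.of_forall fun x => ?_)
  rw [Real.norm_eq_abs, abs_mul, abs_of_nonneg (hp0 x), Pi.add_apply, ← add_mul]
  refine mul_le_mul_of_nonneg_right ?_ (hp0 x)
  rw [abs_le]
  constructor <;> nlinarith [sq_nonneg (s x + t x), sq_nonneg (s x - t x), sq_nonneg (s x),
    sq_nonneg (t x)]

section Real
variable {p : ℝ → ℝ}

lemma deriv_log_mul (hp : Differentiable ℝ p) (hp0 : ∀ x, 0 ≤ p x) (x : ℝ) :
    deriv (fun t => Real.log (p t)) x * p x = deriv p x := by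
  have := lineDeriv_log_mul hp hp0 x 1
  rwa [lineDeriv_one_eq_deriv, lineDeriv_one_eq_deriv] at this

/-- `p'` is score times density, and `|s| ≤ s² + 1` bounds it by the Fisher integrand plus `p`. -/
lemma integrable_deriv_of_fisher (hp : Differentiable ℝ p) (hp0 : ∀ x, 0 ≤ p x)
    (h1 : ∫ x, p x = 1)
    (hI : Integrable fun x => (deriv (fun t => Real.log (p t)) x) ^ 2 * p x) :
    Integrable (deriv p) := by
  have := integrable_mul_of_sq hp0 (s := fun x => deriv (fun t => Real.log (p t)) x)
    (by simp only [deriv_log_mul hp hp0]; exact (measurable_deriv p).aestronglyMeasurable)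
    hI (integrable_of_integral_eq_one h1)
  simpa only [deriv_log_mul hp hp0] using this

lemma integral_deriv_of_fisher (hp : Differentiable ℝ p) (hp0 : ∀ x, 0 ≤ p x)
    (h1 : ∫ x, p x = 1)
    (hI : Integrable fun x => (deriv (fun t => Real.log (p t)) x) ^ 2 * p x) :
    ∫ x, deriv p x = 0 :=
  integral_eq_zero_of_hasDerivAt_of_integrable (fun x => (hp x).hasDerivAt)
    (integrable_deriv_of_fisher hp hp0 h1 hI) (integrable_of_integral_eq_one h1)

/-- The Fisher information of a differentiable density on the line is positive. -/
lemma fisher_pos (hp : Differentiable ℝ p) (hp0 : ∀ x, 0 ≤ p x) (h1 : ∫ x, p x = 1)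
    (hI : Integrable fun x => (deriv (fun t => Real.log (p t)) x) ^ 2 * p x) :
    0 < ∫ x, (deriv (fun t => Real.log (p t)) x) ^ 2 * p x := by
  have hnn : ∀ x, 0 ≤ (deriv (fun t => Real.log (p t)) x) ^ 2 * p x := fun x =>
    mul_nonneg (sq_nonneg _) (hp0 x)
  refine lt_of_le_of_ne (integral_nonneg hnn) fun h0 => ?_
  have hae := (integral_eq_zero_iff_of_nonneg hnn hI).1 h0.symm
  have hd : deriv p =ᵐ[volume] 0 := by
    filter_upwards [hae] with x hx
    rw [← deriv_log_mul hp hp0]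
    rcases mul_eq_zero.1 hx with h | h
    · simp [pow_eq_zero_iff (two_ne_zero)] at h; simp [h]
    · simp [h]
  have hconst : ∀ x, p x = p 0 := by
    intro x
    have := intervalIntegral.integral_eq_sub_of_hasDerivAt (a := 0) (b := x)
      (fun y _ => (hp y).hasDerivAt) (integrable_deriv_of_fisher hp hp0 h1 hI).intervalIntegrable
    rw [intervalIntegral.integral_congr_ae (g := fun _ => (0 : ℝ))
      (by filter_upwards [hd] with y hy _ using hy)] at this
    simp at this
    linarith
  rw [integral_congr_ae (g := fun _ => p 0) (Eventually.of_forall hconst)] at h1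
  -- The line has infinite measure, whose real value is 0, so a constant has integral 0, not 1.
  simp [Measure.real] at h1

end Real

section Plane
variable {p : ℝ × ℝ → ℝ}

/-- The components of the score of a density on the plane. -/
def planeScore (p : ℝ × ℝ → ℝ) (m : Fin 2) (x : ℝ × ℝ) : ℝ :=
  lineDeriv ℝ (fun y => Real.log (p y)) x (alphaDir m)

lemma planeScore_mul (hp : Differentiable ℝ p) (hp0 : ∀ x, 0 ≤ p x) (m : Fin 2) (x : ℝ × ℝ) :
    planeScore p m x * p x = lineDeriv ℝ p x (alphaDir m) :=
  lineDeriv_log_mul hp hp0 x _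

/-- `log p` need not be continuous at zeros of `p`, so measurability is obtained from derivatives of
`p` itself. Division by 0 gives the correct value 0 at the zeros. -/
lemma aestronglyMeasurable_planeScore_mul_mul (hp : Differentiable ℝ p) (hp0 : ∀ x, 0 ≤ p x)
    (m n : Fin 2) :
    AEStronglyMeasurable (fun x => planeScore p m x * planeScore p n x * p x) volume := by
  have h : (fun x => planeScore p m x * planeScore p n x * p x) =
      fun x => lineDeriv ℝ p x (alphaDir m) * lineDeriv ℝ p x (alphaDir n) / p x := by
    ext x
    rw [← planeScore_mul hp hp0, ← planeScore_mul hp hp0]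
    by_cases hx : p x = 0
    · simp [hx]
    · field_simp
  rw [h]
  exact (((measurable_lineDeriv hp.continuous).mul (measurable_lineDeriv hp.continuous)).div
    hp.continuous.measurable).aestronglyMeasurable

lemma integrable_planeScore_mul_mul (hp : Differentiable ℝ p) (hp0 : ∀ x, 0 ≤ p x)
    (hI : ∀ m, Integrable fun x => planeScore p m x ^ 2 * p x) (m n : Fin 2) :
    Integrable (fun x => planeScore p m x * planeScore p n x * p x) :=
  integrable_mul_mul_of_sq hp0 (aestronglyMeasurable_planeScore_mul_mul hp hp0 m n) (hI m) (hI n)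

lemma integrable_planeScore_mul (hp : Differentiable ℝ p) (hp0 : ∀ x, 0 ≤ p x)
    (h1 : ∫ x, p x = 1) (hI : ∀ m, Integrable fun x => planeScore p m x ^ 2 * p x) (m : Fin 2) :
    Integrable (fun x => planeScore p m x * p x) := by
  refine integrable_mul_of_sq hp0 ?_ (hI m) (integrable_of_integral_eq_one h1)
  simp only [planeScore_mul hp hp0]
  exact (measurable_lineDeriv hp.continuous).aestronglyMeasurable

lemma lineDeriv_plane (hp : Differentiable ℝ p) (x : ℝ × ℝ) (a b : ℝ) :
    lineDeriv ℝ p x (a, b) =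
      a * lineDeriv ℝ p x (alphaDir 0) + b * lineDeriv ℝ p x (alphaDir 1) := by
  simp only [(hp x).lineDeriv_eq_fderiv, alphaDir]
  have : ((a, b) : ℝ × ℝ) = a • (1, 0) + b • (0, 1) := by simp
  rw [this, map_add, map_smul, map_smul]
  simp

/-- The Fisher information matrix of a differentiable density on the plane with finite first
moments is positive definite. -/
lemma planeFisher_pos (hp : Differentiable ℝ p) (hp0 : ∀ x, 0 ≤ p x) (h1 : ∫ x, p x = 1)
    (hI : ∀ m, Integrable fun x => planeScore p m x ^ 2 * p x)
    (hx1 : Integrable fun x => x.1 * p x) (hx2 : Integrable fun x => x.2 * p x)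
    {a b : ℝ} (hab : a ^ 2 + b ^ 2 ≠ 0) :
    0 < a ^ 2 * (∫ x, planeScore p 0 x * planeScore p 0 x * p x) +
      2 * a * b * (∫ x, planeScore p 0 x * planeScore p 1 x * p x) +
      b ^ 2 * (∫ x, planeScore p 1 x * planeScore p 1 x * p x) := by
  have hint := integrable_planeScore_mul_mul hp hp0 hI
  have i1 := (hint 0 0).const_mul (a ^ 2)
  have i2 := (hint 0 1).const_mul (2 * a * b)
  have i3 := (hint 1 1).const_mul (b ^ 2)
  have i12 : Integrable fun x => a ^ 2 * (planeScore p 0 x * planeScore p 0 x * p x) +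
      2 * a * b * (planeScore p 0 x * planeScore p 1 x * p x) := i1.add i2
  rw [← integral_const_mul, ← integral_const_mul, ← integral_const_mul, ← integral_add i1 i2,
    ← integral_add i12 i3]
  have hsq : ∀ x, a ^ 2 * (planeScore p 0 x * planeScore p 0 x * p x) +
      2 * a * b * (planeScore p 0 x * planeScore p 1 x * p x) +
      b ^ 2 * (planeScore p 1 x * planeScore p 1 x * p x) =
      (a * planeScore p 0 x + b * planeScore p 1 x) ^ 2 * p x := fun x => by ring
  have hintsq := (i12.add i3).congr (Eventually.of_forall hsq)
  simp only [hsq]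
  have hnn : ∀ x, 0 ≤ (a * planeScore p 0 x + b * planeScore p 1 x) ^ 2 * p x := fun x =>
    mul_nonneg (sq_nonneg _) (hp0 x)
  refine lt_of_le_of_ne (integral_nonneg hnn) fun h0 => ?_
  have hae := (integral_eq_zero_iff_of_nonneg hnn hintsq).1 h0.symm
  have hd : (fun x => lineDeriv ℝ p x (a, b)) =ᵐ[volume] 0 := by
    filter_upwards [hae] with x hx
    rw [lineDeriv_plane hp, ← planeScore_mul hp hp0, ← planeScore_mul hp hp0, ← mul_assoc,
      ← mul_assoc, ← add_mul]
    rcases mul_eq_zero.1 hx with h | h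
    · rw [pow_eq_zero_iff two_ne_zero] at h; simp [h]
    · simp [h]
  have hz : (fun x : ℝ × ℝ => (a * x.1 + b * x.2) * lineDeriv ℝ p x (a, b)) =ᵐ[volume]
      fun _ => (0 : ℝ) := by
    filter_upwards [hd] with x hx
    rw [hx]; simp
  -- Integrating by parts along `(a, b)` against `a x + b y`, whose derivative in that direction is
  -- `a² + b²`, gives `(a² + b²) ∫ p = 0`. The finite first moments make this legitimate.
  have hibp := integral_bilinear_hasLineDerivAt_right_eq_neg_left_of_integrable
    (μ := (volume : Measure (ℝ × ℝ))) (B := ContinuousLinearMap.mul ℝ ℝ)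
    (f := fun x : ℝ × ℝ => a * x.1 + b * x.2) (f' := fun _ => a ^ 2 + b ^ 2)
    (g := p) (g' := fun x => lineDeriv ℝ p x (a, b)) (v := (a, b))
    (by
      simp only [ContinuousLinearMap.mul_apply']
      exact (integrable_of_integral_eq_one h1).const_mul (a ^ 2 + b ^ 2))
    (by
      simp only [ContinuousLinearMap.mul_apply']
      exact (integrable_zero _ _ _).congr hz.symm)
    (by
      simp only [ContinuousLinearMap.mul_apply']
      refine ((hx1.const_mul a).add (hx2.const_mul b)).congr (Eventually.of_forall fun x => ?_)
      simp only [Pi.add_apply]; ring)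
    (fun x _ => by
      have h : HasDerivAt (fun t : ℝ => a * (x.1 + t * a) + b * (x.2 + t * b))
          (a * (1 * a) + b * (1 * b)) 0 :=
        ((((hasDerivAt_id (0 : ℝ)).mul_const a).const_add x.1).const_mul a).add
          ((((hasDerivAt_id (0 : ℝ)).mul_const b).const_add x.2).const_mul b)
      simp only [HasLineDerivAt]
      refine h.congr_deriv ?_
      ring)
    (fun x _ => (hp x).hasFDerivAt.hasLineDerivAt _ |>.congr_deriv
      ((hp x).lineDeriv_eq_fderiv).symm)
  simp only [ContinuousLinearMap.mul_apply', integral_congr_ae hz, integral_zero,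
    integral_const_mul, h1, mul_one] at hibp
  exact hab (by linarith)

end Plane

end Score

/-! ### The prior information matrix. -/

namespace MIMOOFDM
variable {NT NR nT nR K : ℕ} {Ns : Fin K → ℕ}

/-- The standing assumptions on the array and on the prior. -/
structure IsRegular (sys : MIMOOFDM NT NR nT nR K Ns) : Prop where
  NR_pos : 0 < NR
  dvd : nR ∣ NR
  connected : IsPartiallyConnected sys.W
  noiseVar_pos : 0 < sys.noiseVar
  diff_a : Differentiable ℝ sys.a
  diff_b : Differentiable ℝ sys.b
  pΘ_nonneg : ∀ θ, 0 ≤ sys.pΘ θ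
  integral_pΘ : ∫ θ, sys.pΘ θ = 1
  diff_pΘ : Differentiable ℝ sys.pΘ
  info_pΘ : Integrable fun θ => (deriv (fun t => Real.log (sys.pΘ t)) θ) ^ 2 * sys.pΘ θ
  pα_nonneg : ∀ x, 0 ≤ sys.pα x
  integral_pα : ∫ x, sys.pα x = 1
  diff_pα : Differentiable ℝ sys.pα
  info_pα : ∀ m : Fin 2, Integrable fun x => planeScore sys.pα m x ^ 2 * sys.pα x
  sq_pα : Integrable fun x : ℝ × ℝ => (x.1 ^ 2 + x.2 ^ 2) * sys.pα x
  mean_re : ∫ x : ℝ × ℝ, x.1 * sys.pα x = 0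
  mean_im : ∫ x : ℝ × ℝ, x.2 * sys.pα x = 0
  sq_M : ∀ i j, Integrable fun θ => ‖sys.M θ i j‖ ^ 2 * sys.pΘ θ
  sq_Mdot : ∀ i j, Integrable fun θ => ‖sys.Mdot θ i j‖ ^ 2 * sys.pΘ θ

namespace IsRegular
variable {sys : MIMOOFDM NT NR nT nR K Ns}

lemma integrable_pΘ (h : sys.IsRegular) : Integrable sys.pΘ :=
  integrable_of_integral_eq_one h.integral_pΘ

lemma integrable_pα (h : sys.IsRegular) : Integrable sys.pα :=
  integrable_of_integral_eq_one h.integral_pα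

lemma pZ_nonneg (h : sys.IsRegular) (ζ : ℝ × ℝ × ℝ) : 0 ≤ sys.pZ ζ :=
  mul_nonneg (h.pΘ_nonneg _) (h.pα_nonneg _)

lemma diff_pZ (h : sys.IsRegular) : Differentiable ℝ sys.pZ :=
  (h.diff_pΘ.comp differentiable_fst).mul (h.diff_pα.comp differentiable_snd)

lemma integrable_re_mul_pα (h : sys.IsRegular) : Integrable fun x => x.1 * sys.pα x := by
  refine integrable_mul_of_sq h.pα_nonneg ?_ ?_ h.integrable_pα
  · exact (continuous_fst.mul h.diff_pα.continuous).aestronglyMeasurable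
  · refine h.sq_pα.mono' ((continuous_fst.pow 2).mul
      h.diff_pα.continuous).aestronglyMeasurable (Eventually.of_forall fun x => ?_)
    have := h.pα_nonneg x
    rw [Real.norm_of_nonneg (by positivity)]
    nlinarith [mul_nonneg (sq_nonneg x.2) this]

lemma integrable_im_mul_pα (h : sys.IsRegular) : Integrable fun x => x.2 * sys.pα x := by
  refine integrable_mul_of_sq h.pα_nonneg ?_ ?_ h.integrable_pα
  · exact (continuous_snd.mul h.diff_pα.continuous).aestronglyMeasurable
  · refine h.sq_pα.mono' ((continuous_snd.pow 2).mul
      h.diff_pα.continuous).aestronglyMeasurable (Eventually.of_forall fun x => ?_)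
    have := h.pα_nonneg x
    rw [Real.norm_of_nonneg (by positivity)]
    nlinarith [mul_nonneg (sq_nonneg x.1) this]

lemma paramDeriv_log_pZ_zero (h : sys.IsRegular) {ζ : ℝ × ℝ × ℝ} (hζ : sys.pZ ζ ≠ 0) :
    paramDeriv (fun ξ => Real.log (sys.pZ ξ)) 0 ζ =
      deriv (fun t => Real.log (sys.pΘ t)) ζ.1 := by
  have hne := mul_ne_zero_iff.1 hζ
  rw [paramDeriv, lineDeriv_log (h.diff_pZ ζ) hζ, ← lineDeriv_one_eq_deriv,
    lineDeriv_log (h.diff_pΘ _) hne.1, lineDeriv_one_eq_deriv]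
  have : lineDeriv ℝ sys.pZ ζ (paramDir 0) = deriv sys.pΘ ζ.1 * sys.pα ζ.2 := by
    simp [lineDeriv, paramDir, pZ, deriv_mul_const_field, deriv_comp_const_add,
      show ((0, 0) : ℝ × ℝ) = 0 from rfl]
  rw [this, pZ, mul_div_mul_right _ _ hne.2]

lemma paramDeriv_log_pZ_succ (h : sys.IsRegular) {ζ : ℝ × ℝ × ℝ} (hζ : sys.pZ ζ ≠ 0)
    (m : Fin 2) :
    paramDeriv (fun ξ => Real.log (sys.pZ ξ)) m.succ ζ = planeScore sys.pα m ζ.2 := by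
  have hne := mul_ne_zero_iff.1 hζ
  rw [paramDeriv, lineDeriv_log (h.diff_pZ ζ) hζ, planeScore, lineDeriv_log (h.diff_pα _) hne.2]
  have : lineDeriv ℝ sys.pZ ζ (paramDir m.succ) =
      sys.pΘ ζ.1 * lineDeriv ℝ sys.pα ζ.2 (alphaDir m) := by
    have : paramDir m.succ = (0, alphaDir m) := by fin_cases m <;> rfl
    simp [lineDeriv, this, pZ, deriv_const_mul_field]
  rw [this, pZ, mul_div_mul_left _ _ hne.1]

/-- Off the zeros of `pZ` the logarithm of the product separates; at the zeros both sides are killed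
by a vanishing density. The next entries follow the same pattern. -/
lemma priorIntegrand_zero_zero (h : sys.IsRegular) (ζ : ℝ × ℝ × ℝ) :
    sys.priorIntegrand 0 0 ζ =
      (deriv (fun t => Real.log (sys.pΘ t)) ζ.1) ^ 2 * sys.pΘ ζ.1 * sys.pα ζ.2 := by
  by_cases hζ : sys.pZ ζ = 0
  · rw [priorIntegrand, hζ, mul_zero]
    rcases mul_eq_zero.1 hζ with h0 | h0 <;> simp [h0]
  · rw [priorIntegrand, h.paramDeriv_log_pZ_zero hζ, pZ]; ring

lemma priorIntegrand_zero_succ (h : sys.IsRegular) (m : Fin 2) (ζ : ℝ × ℝ × ℝ) :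
    sys.priorIntegrand 0 m.succ ζ =
      deriv sys.pΘ ζ.1 * (planeScore sys.pα m ζ.2 * sys.pα ζ.2) := by
  rw [← deriv_log_mul h.diff_pΘ h.pΘ_nonneg]
  by_cases hζ : sys.pZ ζ = 0
  · rw [priorIntegrand, hζ, mul_zero]
    rcases mul_eq_zero.1 hζ with h0 | h0 <;> simp [h0]
  · rw [priorIntegrand, h.paramDeriv_log_pZ_zero hζ, h.paramDeriv_log_pZ_succ hζ, pZ]; ring

lemma priorIntegrand_comm (i j : Fin 3) (ζ : ℝ × ℝ × ℝ) :
    sys.priorIntegrand i j ζ = sys.priorIntegrand j i ζ := by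
  simp only [priorIntegrand]; ring

lemma priorIntegrand_succ_succ (h : sys.IsRegular) (m n : Fin 2) (ζ : ℝ × ℝ × ℝ) :
    sys.priorIntegrand m.succ n.succ ζ =
      sys.pΘ ζ.1 * (planeScore sys.pα m ζ.2 * planeScore sys.pα n ζ.2 * sys.pα ζ.2) := by
  by_cases hζ : sys.pZ ζ = 0
  · rw [priorIntegrand, hζ, mul_zero]
    rcases mul_eq_zero.1 hζ with h0 | h0 <;> simp [h0]
  · rw [priorIntegrand, h.paramDeriv_log_pZ_succ hζ, h.paramDeriv_log_pZ_succ hζ, pZ]; ring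

lemma integrable_priorIntegrand (h : sys.IsRegular) (i j : Fin 3) :
    Integrable (sys.priorIntegrand i j) := by
  have h0s : ∀ m : Fin 2, Integrable (sys.priorIntegrand 0 m.succ) := fun m => by
    rw [funext (h.priorIntegrand_zero_succ m)]
    exact (integrable_deriv_of_fisher h.diff_pΘ h.pΘ_nonneg h.integral_pΘ h.info_pΘ).mul_prod
      (integrable_planeScore_mul h.diff_pα h.pα_nonneg h.integral_pα h.info_pα m)
  cases i using Fin.cases with
  | zero =>
    cases j using Fin.cases with
    | zero =>
      rw [funext h.priorIntegrand_zero_zero]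
      exact h.info_pΘ.mul_prod h.integrable_pα
    | succ n => exact h0s n
  | succ m =>
    cases j using Fin.cases with
    | zero =>
      rw [funext (priorIntegrand_comm _ _)]
      exact h0s m
    | succ n =>
      rw [funext (h.priorIntegrand_succ_succ m n)]
      exact h.integrable_pΘ.mul_prod
        (integrable_planeScore_mul_mul h.diff_pα h.pα_nonneg h.info_pα m n)

lemma FP_zero_zero (h : sys.IsRegular) : sys.FP 0 0 = sys.priorInfoΘ := by
  simp only [FP, Matrix.of_apply, h.priorIntegrand_zero_zero]
  refine (integral_prod_mul (μ := (volume : Measure ℝ)) (ν := (volume : Measure (ℝ × ℝ)))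
    (fun θ => (deriv (fun t => Real.log (sys.pΘ t)) θ) ^ 2 * sys.pΘ θ) sys.pα).trans ?_
  rw [h.integral_pα, mul_one, priorInfoΘ]

lemma FP_zero_succ (h : sys.IsRegular) (m : Fin 2) : sys.FP 0 m.succ = 0 := by
  simp only [FP, Matrix.of_apply, h.priorIntegrand_zero_succ]
  refine (integral_prod_mul (μ := (volume : Measure ℝ)) (ν := (volume : Measure (ℝ × ℝ)))
    (deriv sys.pΘ) (fun x => planeScore sys.pα m x * sys.pα x)).trans ?_
  rw [integral_deriv_of_fisher h.diff_pΘ h.pΘ_nonneg h.integral_pΘ h.info_pΘ, zero_mul]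

lemma FP_comm (i j : Fin 3) : sys.FP i j = sys.FP j i := by
  simp only [FP, Matrix.of_apply]
  exact integral_congr_ae (Eventually.of_forall (priorIntegrand_comm i j))

lemma FP_succ_succ (h : sys.IsRegular) (m n : Fin 2) :
    sys.FP m.succ n.succ =
      ∫ x, planeScore sys.pα m x * planeScore sys.pα n x * sys.pα x := by
  simp only [FP, Matrix.of_apply, h.priorIntegrand_succ_succ]
  refine (integral_prod_mul (μ := (volume : Measure ℝ)) (ν := (volume : Measure (ℝ × ℝ)))
    sys.pΘ (fun x => planeScore sys.pα m x * planeScore sys.pα n x * sys.pα x)).trans ?_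
  rw [h.integral_pΘ, one_mul]

lemma priorInfoΘ_pos (h : sys.IsRegular) : 0 < sys.priorInfoΘ :=
  fisher_pos h.diff_pΘ h.pΘ_nonneg h.integral_pΘ h.info_pΘ

lemma FP_quadForm_pos (h : sys.IsRegular) {a b : ℝ} (hab : a ^ 2 + b ^ 2 ≠ 0) :
    0 < a ^ 2 * sys.FP 1 1 + 2 * a * b * sys.FP 1 2 + b ^ 2 * sys.FP 2 2 := by
  have := planeFisher_pos h.diff_pα h.pα_nonneg h.integral_pα h.info_pα h.integrable_re_mul_pα
    h.integrable_im_mul_pα hab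
  rwa [← h.FP_succ_succ 0 0, ← h.FP_succ_succ 0 1, ← h.FP_succ_succ 1 1] at this

end IsRegular
end MIMOOFDM

/-! ### Block-diagonal `3 × 3` matrices. -/

section ThreeByThree

lemma isUnit_of_cross_eq_zero {F : Matrix (Fin 3) (Fin 3) ℝ} (h1 : F 1 0 = 0) (h2 : F 2 0 = 0)
    (h0 : F 0 0 ≠ 0) (hd : F 1 1 * F 2 2 - F 1 2 * F 2 1 ≠ 0) : IsUnit F := by
  rw [Matrix.isUnit_iff_isUnit_det, isUnit_iff_ne_zero, Matrix.det_fin_three]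
  rw [h1, h2]
  convert mul_ne_zero h0 hd using 1
  ring

lemma inv_zero_zero_of_cross_eq_zero {F : Matrix (Fin 3) (Fin 3) ℝ} (hF : IsUnit F)
    (h1 : F 1 0 = 0) (h2 : F 2 0 = 0) : F⁻¹ 0 0 = 1 / F 0 0 := by
  have h := congrFun₂ (Matrix.nonsing_inv_mul F ((Matrix.isUnit_iff_isUnit_det F).1 hF)) 0 0
  rw [Matrix.mul_apply, Fin.sum_univ_three, h1, h2] at h
  simp only [mul_zero, add_zero, Matrix.one_apply_eq] at h
  exact eq_one_div_of_mul_eq_one_left h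

lemma det_pos_of_quadForm_pos {p q r : ℝ}
    (h : ∀ a b : ℝ, a ^ 2 + b ^ 2 ≠ 0 → 0 < a ^ 2 * p + 2 * a * b * q + b ^ 2 * r) :
    0 < p ∧ 0 < r ∧ 0 < p * r - q * q := by
  have hp : 0 < p := by simpa using h 1 0 (by norm_num)
  have hr : 0 < r := by simpa using h 0 1 (by norm_num)
  refine ⟨hp, hr, ?_⟩
  -- At `(q, -p)` the form equals `p (p r - q²)`.
  have := h q (-p) (by nlinarith [sq_nonneg q, mul_pos hp hp])
  have h2 : 0 < p * (p * r - q * q) := by linarith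
  exact pos_of_mul_pos_right h2 hp.le

end ThreeByThree

/-! ### Mean, covariance and score of the observation. -/

lemma cgPi_eq {ι : Type*} [Fintype ι] (c : ℝ) (y : ι → ℂ) :
    cgPi c y = (c / Real.pi) ^ Fintype.card ι * Real.exp (-c * ∑ p, ‖y p‖ ^ 2) := by
  simp only [cgPi, cgDensity, Finset.prod_mul_distrib, ← Real.exp_sum, ← Finset.mul_sum,
    Finset.prod_const, Finset.card_univ]

namespace MIMOOFDM
variable {NT NR nT nR K : ℕ} {Ns : Fin K → ℕ} (sys : MIMOOFDM NT NR nT nR K Ns)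
variable {L : ℕ} (S : (k : Fin K) → Matrix (Fin (Ns k)) (Fin L) ℂ)

/-- The transmitted signal `x_{k,l} = V_RF V_BB,k s_{k,l}`. -/
def tx (k : Fin K) (l : Fin L) : Fin NT → ℂ := (sys.VRF * sys.VBB k) *ᵥ fun i => S k i l

/-- The beamformed echo of the transmitted signals for the response matrix `G`. -/
def echo (G : Matrix (Fin NR) (Fin NT) ℂ) (p : Fin L × (Σ _ : Fin K, Fin nR)) : ℂ :=
  (sys.Wᴴ *ᵥ (G *ᵥ sys.tx S p.2.1 p.1)) p.2.2

lemma obsMean_eq (ζ : ℝ × ℝ × ℝ) :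
    sys.obsMean S ζ = ((ζ.2.1 : ℂ) + (ζ.2.2 : ℂ) * Complex.I) • sys.echo S (sys.M ζ.1) := by
  rw [obsMean]
  congr 1
  ext ⟨l, k, r⟩
  rw [← Matrix.blockDiagonal'_mul, ← Matrix.blockDiagonal'_mul, Matrix.vec, Matrix.mul_apply,
    Fintype.sum_sigma, Finset.sum_eq_single k]
  · simp only [Matrix.blockDiagonal'_apply_eq, echo, tx, Matrix.mulVec_mulVec, stack,
      Matrix.of_apply]
    rw [← Matrix.mul_assoc, ← Matrix.mul_assoc]
    rfl
  · intro k' _ hk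
    refine Finset.sum_eq_zero fun i _ => ?_
    simp [Matrix.blockDiagonal'_apply_ne _ _ _ (Ne.symm hk)]
  · simp

variable {sys}

namespace IsRegular

lemma nR_pos (h : sys.IsRegular) : 0 < nR := Nat.pos_of_dvd_of_pos h.dvd h.NR_pos

lemma ratio_pos (h : sys.IsRegular) : 0 < NR / nR := Nat.div_pos_iff.2
  ⟨h.nR_pos, Nat.le_of_dvd h.NR_pos h.dvd⟩

/-- A diagonal entry counts the antennas of one block, each contributing modulus 1; off the diagonal
the blocks are disjoint and every summand is 0. -/
lemma conjTranspose_W_mul_W (h : sys.IsRegular) :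
    sys.Wᴴ * sys.W = (((NR / nR : ℕ) : ℝ) : ℂ) • (1 : Matrix (Fin nR) (Fin nR) ℂ) := by
  have hQ := h.ratio_pos
  have hW := h.connected
  obtain ⟨Q, hQe⟩ : ∃ Q, NR / nR = Q := ⟨_, rfl⟩
  simp only [IsPartiallyConnected, hQe] at hW
  rw [hQe] at hQ ⊢
  have hNR : NR = nR * Q := by rw [← hQe, Nat.mul_div_cancel' h.dvd]
  have hstar : ∀ i j, sys.W j i = star (sys.Wᴴ i j) := fun i j => by simp
  ext i j
  rw [Matrix.mul_apply]
  by_cases hij : i = j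
  · subst hij
    have e : ∀ n, sys.Wᴴ i n * sys.W n i =
        if (i : ℕ) * Q ≤ (n : ℕ) ∧ (n : ℕ) < ((i : ℕ) + 1) * Q then 1 else 0 := by
      intro n
      rw [hstar, Complex.star_def, Complex.mul_conj, Complex.normSq_eq_norm_sq, hW]
      split_ifs <;> simp
    simp only [e, Finset.sum_boole, Matrix.smul_apply, Matrix.one_apply_eq, smul_eq_mul, mul_one,
      Complex.ofReal_natCast]
    congr 1
    -- Divisibility makes the last block fit inside the array, so every block has exactly `Q`
    -- antennas.
    have hle : (i + 1 : ℕ) * Q ≤ NR := by rw [hNR]; exact Nat.mul_le_mul_right _ i.2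
    have hmap : (Finset.univ.filter fun n : Fin NR =>
        (i : ℕ) * Q ≤ (n : ℕ) ∧ (n : ℕ) < ((i : ℕ) + 1) * Q).map Fin.valEmbedding =
        Finset.Ico ((i : ℕ) * Q) (((i : ℕ) + 1) * Q) := by
      ext n
      simp only [Finset.mem_map, Finset.mem_filter, Finset.mem_univ, true_and, Finset.mem_Ico,
        Fin.valEmbedding_apply]
      exact ⟨fun ⟨m, hm, hmn⟩ => hmn ▸ hm, fun hn => ⟨⟨n, hn.2.trans_le hle⟩, hn, rfl⟩⟩
    rw [← Finset.card_map Fin.valEmbedding, hmap, Nat.card_Ico, ← Nat.sub_mul]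
    simp
  · rw [Matrix.smul_apply, Matrix.one_apply_ne hij, smul_zero]
    refine Finset.sum_eq_zero fun n _ => ?_
    by_contra hne
    have h1 := norm_ne_zero_iff.2 (left_ne_zero_of_mul hne)
    have h2 := norm_ne_zero_iff.2 (right_ne_zero_of_mul hne)
    rw [hstar, norm_star, hW] at h2
    rw [hW] at h1
    simp only [ne_eq, ite_eq_right_iff, one_ne_zero, imp_false, not_not] at h1 h2
    -- An antenna common to blocks `i` and `j` forces `i < j + 1` and `j < i + 1`.
    have a1 := Nat.lt_of_mul_lt_mul_right (h1.1.trans_lt h2.2)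
    have a2 := Nat.lt_of_mul_lt_mul_right (h2.1.trans_lt h1.2)
    exact hij (Fin.ext (by omega))

lemma obsCov_eq (h : sys.IsRegular) (L : ℕ) :
    sys.obsCov L = ((sys.noiseVar * ((NR / nR : ℕ) : ℝ) : ℝ) : ℂ) • 1 := by
  rw [obsCov, Matrix.conjTranspose_kronecker, ← Matrix.mul_kronecker_mul,
    Matrix.conjTranspose_one, one_mul, Matrix.blockDiagonal'_conjTranspose,
    ← Matrix.blockDiagonal'_mul]
  simp only [Matrix.conjTranspose_conjTranspose, h.conjTranspose_W_mul_W]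
  have : (Matrix.blockDiagonal' fun _ : Fin K =>
      (((NR / nR : ℕ) : ℝ) : ℂ) • (1 : Matrix (Fin nR) (Fin nR) ℂ)) =
      (((NR / nR : ℕ) : ℝ) : ℂ) • 1 := by
    rw [← Matrix.blockDiagonal'_one, ← Matrix.blockDiagonal'_smul]; rfl
  rw [this, Matrix.kronecker_smul, Matrix.one_kronecker_one, smul_smul, Complex.ofReal_mul]

end IsRegular

variable (sys)

/-- The inverse of the noise power after receive beamforming. -/
def precision : ℝ := (sys.noiseVar * ((NR / nR : ℕ) : ℝ))⁻¹

/-- The derivatives of the mean observation. -/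
def dMean (i : Fin 3) (ζ : ℝ × ℝ × ℝ) : Fin L × (Σ _ : Fin K, Fin nR) → ℂ :=
  ![((ζ.2.1 : ℂ) + (ζ.2.2 : ℂ) * Complex.I) • sys.echo S (sys.Mdot ζ.1),
    sys.echo S (sys.M ζ.1), Complex.I • sys.echo S (sys.M ζ.1)] i

variable {sys}

namespace IsRegular

lemma precision_pos (h : sys.IsRegular) : 0 < sys.precision :=
  inv_pos.2 (mul_pos h.noiseVar_pos (by exact_mod_cast h.ratio_pos))

lemma precision_eq (h : sys.IsRegular) : sys.precision = nR / (NR * sys.noiseVar) := by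
  have : (nR : ℝ) ≠ 0 := by exact_mod_cast h.nR_pos.ne'
  rw [precision, Nat.cast_div h.dvd this, mul_comm, div_mul_eq_mul_div, inv_div]

lemma obsCov_inv (h : sys.IsRegular) (L : ℕ) : (sys.obsCov L)⁻¹ = (sys.precision : ℂ) • 1 := by
  refine Matrix.inv_eq_left_inv ?_
  rw [h.obsCov_eq, smul_mul_smul_comm, one_mul, ← Complex.ofReal_mul, precision,
    inv_mul_cancel₀ (inv_pos.1 h.precision_pos).ne', Complex.ofReal_one, one_smul]

lemma hasDerivAt_M (h : sys.IsRegular) (θ : ℝ) (i : Fin NR) (j : Fin NT) :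
    HasDerivAt (fun t => sys.M t i j) (sys.Mdot θ i j) θ := by
  have : DifferentiableAt ℝ (fun t => sys.M t i j) θ :=
    ((differentiable_pi.1 h.diff_b i) θ).mul ((differentiable_pi.1 h.diff_a j) θ).star
  exact this.hasDerivAt

lemma hasDerivAt_echo (h : sys.IsRegular) (θ : ℝ) :
    HasDerivAt (fun t => sys.echo S (sys.M t)) (sys.echo S (sys.Mdot θ)) θ := by
  refine hasDerivAt_pi.2 fun p => ?_
  simp only [echo, Matrix.mulVec, dotProduct]
  exact HasDerivAt.fun_sum fun i _ => (HasDerivAt.fun_sum fun j _ =>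
    (h.hasDerivAt_M θ i j).mul_const _).const_mul _

lemma hasLineDerivAt_obsMean (h : sys.IsRegular) (i : Fin 3) (ζ : ℝ × ℝ × ℝ) :
    HasLineDerivAt ℝ (sys.obsMean S) (sys.dMean S i ζ) ζ (paramDir i) := by
  rw [HasLineDerivAt, funext (sys.obsMean_eq S)]
  have hid : HasDerivAt (fun t : ℝ => (t : ℂ)) 1 0 := (hasDerivAt_id (0 : ℝ)).ofReal_comp
  fin_cases i
  · have h1 : HasDerivAt (fun t : ℝ => sys.echo S (sys.M (ζ.1 + t)))
        (sys.echo S (sys.Mdot ζ.1)) 0 :=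
      HasDerivAt.comp_const_add (f := fun t => sys.echo S (sys.M t)) ζ.1 0
        (by rw [add_zero]; exact h.hasDerivAt_echo S ζ.1)
    simpa [paramDir, dMean, Pi.smul_def] using
      h1.fun_const_smul ((ζ.2.1 : ℂ) + (ζ.2.2 : ℂ) * Complex.I)
  · have h1 := ((hid.const_add (ζ.2.1 : ℂ)).add_const
      ((ζ.2.2 : ℂ) * Complex.I)).smul_const (sys.echo S (sys.M ζ.1))
    simpa [paramDir, dMean] using h1
  · have h1 := (((hid.const_add (ζ.2.2 : ℂ)).mul_const Complex.I).const_add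
      (ζ.2.1 : ℂ)).smul_const (sys.echo S (sys.M ζ.1))
    simpa [paramDir, dMean] using h1

lemma paramDeriv_obsMean (h : sys.IsRegular) (i : Fin 3) (ζ : ℝ × ℝ × ℝ) :
    paramDeriv (sys.obsMean S) i ζ = sys.dMean S i ζ :=
  (h.hasLineDerivAt_obsMean S i ζ).lineDeriv

lemma likelihood_eq (h : sys.IsRegular) (ζ : ℝ × ℝ × ℝ)
    (y : Fin L × (Σ _ : Fin K, Fin nR) → ℂ) :
    sys.likelihood S ζ y = cgPi sys.precision (y - sys.obsMean S ζ) := by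
  rw [likelihood, h.obsCov_eq, cnPDF_smul_one (inv_pos.1 h.precision_pos)]
  rfl

/-- The covariance does not depend on `ζ`, so the log-likelihood is a constant minus `c ‖y - ū‖²`,
and only the mean is differentiated. -/
lemma paramDeriv_log_likelihood (h : sys.IsRegular) (i : Fin 3) (ζ : ℝ × ℝ × ℝ)
    (y : Fin L × (Σ _ : Fin K, Fin nR) → ℂ) :
    paramDeriv (fun ξ => Real.log (sys.likelihood S ξ y)) i ζ =
      2 * sys.precision * (star (sys.dMean S i ζ) ⬝ᵥ (y - sys.obsMean S ζ)).re := by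
  have hc := h.precision_pos
  have hlog : ∀ ξ, Real.log (sys.likelihood S ξ y) =
      Real.log ((sys.precision / Real.pi) ^
        Fintype.card (Fin L × (Σ _ : Fin K, Fin nR))) +
        -sys.precision * ∑ p, ‖y p - sys.obsMean S ξ p‖ ^ 2 := by
    intro ξ
    rw [h.likelihood_eq, cgPi_eq, Real.log_mul (by positivity) (Real.exp_ne_zero _),
      Real.log_exp]
    rfl
  simp only [hlog]
  refine HasLineDerivAt.lineDeriv ?_
  rw [HasLineDerivAt]
  have hd := hasDerivAt_pi.1 (h.hasLineDerivAt_obsMean S i ζ)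
  have := ((HasDerivAt.fun_sum (u := Finset.univ) fun p _ =>
    ((hd p).const_sub (y p)).norm_sq).const_mul (-sys.precision)).const_add
      (Real.log ((sys.precision / Real.pi) ^ Fintype.card (Fin L × (Σ _ : Fin K, Fin nR))))
  refine this.congr_deriv ?_
  simp only [dotProduct, Complex.re_sum, Finset.mul_sum, zero_smul, add_zero]
  refine Finset.sum_congr rfl fun p _ => ?_
  simp only [Complex.inner, Pi.star_apply, Pi.sub_apply, Complex.star_def, Complex.mul_re,
    Complex.conj_re, Complex.conj_im, Complex.neg_re, Complex.neg_im, Complex.sub_re,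
    Complex.sub_im]
  ring

end IsRegular
end MIMOOFDM

/-! ### Square integrability under the angle prior, and echo energy as a trace. -/

/-- Square integrability of a complex function with respect to the weight `p`. -/
def WeightedL2 (p : ℝ → ℝ) (f : ℝ → ℂ) : Prop :=
  MemLp (fun θ => ((Real.sqrt (p θ) : ℝ) : ℂ) * f θ) 2

namespace WeightedL2
variable {p : ℝ → ℝ} {f g : ℝ → ℂ}

lemma of_sq (hp0 : ∀ θ, 0 ≤ p θ) (hp : Measurable p) (hf : Measurable f)
    (hi : Integrable fun θ => ‖f θ‖ ^ 2 * p θ) : WeightedL2 p f := by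
  refine (memLp_two_iff_integrable_sq_norm
    ((Complex.measurable_ofReal.comp hp.sqrt).mul hf).aestronglyMeasurable).2
    (hi.congr (Eventually.of_forall fun θ => ?_))
  simp only [Pi.mul_apply, Function.comp_apply, norm_mul, Complex.norm_real,
    Real.norm_of_nonneg (Real.sqrt_nonneg _), mul_pow, Real.sq_sqrt (hp0 θ), mul_comm]

lemma const_mul (hf : WeightedL2 p f) (c : ℂ) : WeightedL2 p fun θ => c * f θ := by
  have := MemLp.const_mul hf c
  unfold WeightedL2
  convert this using 2
  ring

lemma mul_const (hf : WeightedL2 p f) (c : ℂ) : WeightedL2 p fun θ => f θ * c := by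
  simpa only [mul_comm c] using hf.const_mul c

lemma sum {ι : Type*} {s : Finset ι} {f : ι → ℝ → ℂ} (hf : ∀ i ∈ s, WeightedL2 p (f i)) :
    WeightedL2 p fun θ => ∑ i ∈ s, f i θ := by
  have := memLp_finsetSum s hf
  unfold WeightedL2
  simpa only [Finset.mul_sum] using this

lemma integrable_conj_mul (hp0 : ∀ θ, 0 ≤ p θ) (hf : WeightedL2 p f) (hg : WeightedL2 p g) :
    Integrable fun θ => star (f θ) * g θ * (p θ : ℂ) := by
  have := MemLp.integrable_mul hf.star hg
  refine this.congr (Eventually.of_forall fun θ => ?_)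
  have hs : ((Real.sqrt (p θ) : ℝ) : ℂ) * ((Real.sqrt (p θ) : ℝ) : ℂ) = p θ := by
    rw [← Complex.ofReal_mul, Real.mul_self_sqrt (hp0 θ)]
  simp only [Pi.mul_apply, Pi.star_apply, star_mul', Complex.star_def, Complex.conj_ofReal]
  rw [← hs]; ring

lemma integrable_sq (hp0 : ∀ θ, 0 ≤ p θ) (hf : WeightedL2 p f) :
    Integrable fun θ => ‖f θ‖ ^ 2 * p θ := by
  refine (hf.integrable_conj_mul hp0 hf).norm.congr (Eventually.of_forall fun θ => ?_)
  beta_reduce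
  rw [norm_mul, norm_mul, norm_star, Complex.norm_real, Real.norm_of_nonneg (hp0 θ), sq]

end WeightedL2

lemma star_dotProduct_self_eq {ι : Type*} [Fintype ι] (v : ι → ℂ) :
    star v ⬝ᵥ v = ((∑ i, ‖v i‖ ^ 2 : ℝ) : ℂ) := by
  simp only [dotProduct, Pi.star_apply, Complex.ofReal_sum]
  refine Finset.sum_congr rfl fun i _ => ?_
  rw [mul_comm, Complex.star_def, Complex.mul_conj, Complex.normSq_eq_norm_sq]

namespace MIMOOFDM
variable {NT NR nT nR K : ℕ} {Ns : Fin K → ℕ} (sys : MIMOOFDM NT NR nT nR K Ns)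
variable {L : ℕ} (S : (k : Fin K) → Matrix (Fin (Ns k)) (Fin L) ℂ)

/-- The weighted Gram matrix `∫ Gᴴ W Wᴴ G p_Θ dθ` of a family of response matrices. -/
def gram (G : ℝ → Matrix (Fin NR) (Fin NT) ℂ) : Matrix (Fin NT) (Fin NT) ℂ :=
  Matrix.of fun i j => ∫ θ, ((G θ)ᴴ * sys.W * sys.Wᴴ * G θ) i j * (sys.pΘ θ : ℂ)

/-- The mean energy of the echo. -/
def echoEnergy (G : ℝ → Matrix (Fin NR) (Fin NT) ℂ) : ℝ :=
  ∫ θ, (∑ p, ‖sys.echo S (G θ) p‖ ^ 2) * sys.pΘ θ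

variable {sys}

namespace IsRegular
variable {G : ℝ → Matrix (Fin NR) (Fin NT) ℂ}

lemma continuous_M (h : sys.IsRegular) (i : Fin NR) (j : Fin NT) :
    Continuous fun θ => sys.M θ i j :=
  continuous_iff_continuousAt.2 fun θ => (h.hasDerivAt_M θ i j).continuousAt

lemma measurable_Mdot (i : Fin NR) (j : Fin NT) : Measurable fun θ => sys.Mdot θ i j :=
  measurable_deriv _

lemma weightedL2_M (h : sys.IsRegular) (i : Fin NR) (j : Fin NT) :
    WeightedL2 sys.pΘ fun θ => sys.M θ i j :=
  .of_sq h.pΘ_nonneg h.diff_pΘ.continuous.measurable (h.continuous_M i j).measurable (h.sq_M i j)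

lemma weightedL2_Mdot (h : sys.IsRegular) (i : Fin NR) (j : Fin NT) :
    WeightedL2 sys.pΘ fun θ => sys.Mdot θ i j :=
  .of_sq h.pΘ_nonneg h.diff_pΘ.continuous.measurable (measurable_Mdot i j) (h.sq_Mdot i j)

lemma weightedL2_beamformed (hG : ∀ i j, WeightedL2 sys.pΘ fun θ => G θ i j)
    (x : Fin NT → ℂ) (r : Fin nR) :
    WeightedL2 sys.pΘ fun θ => (sys.Wᴴ *ᵥ (G θ *ᵥ x)) r := by
  simp only [Matrix.mulVec, dotProduct]
  exact .sum fun i _ => (WeightedL2.sum fun j _ => (hG i j).mul_const _).const_mul _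

lemma integrable_gram (h : sys.IsRegular) (hG : ∀ i j, WeightedL2 sys.pΘ fun θ => G θ i j)
    (i j : Fin NT) :
    Integrable fun θ => ((G θ)ᴴ * sys.W * sys.Wᴴ * G θ) i j * (sys.pΘ θ : ℂ) := by
  have hw : ∀ r j, WeightedL2 sys.pΘ fun θ => (sys.Wᴴ * G θ) r j := fun r j => by
    simp only [Matrix.mul_apply]
    exact .sum fun i _ => (hG i j).const_mul _
  have : ∀ θ, ((G θ)ᴴ * sys.W * sys.Wᴴ * G θ) i j * (sys.pΘ θ : ℂ) =
      ∑ r, star ((sys.Wᴴ * G θ) r i) * (sys.Wᴴ * G θ) r j * (sys.pΘ θ : ℂ) := by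
    intro θ
    have e : (G θ)ᴴ * sys.W * sys.Wᴴ * G θ = (sys.Wᴴ * G θ)ᴴ * (sys.Wᴴ * G θ) := by
      simp [Matrix.conjTranspose_mul, Matrix.mul_assoc]
    rw [e, Matrix.mul_apply, Finset.sum_mul]
    rfl
  simp only [this]
  exact integrable_finsetSum _ fun r _ => (hw r i).integrable_conj_mul h.pΘ_nonneg (hw r j)

/-- Pointwise `Gᴴ W Wᴴ G` is the Gram matrix of `Wᴴ G`. This identity yields both the trace formula
for the energy and the positivity of `A₁`. -/
lemma gram_quadForm (h : sys.IsRegular) (hG : ∀ i j, WeightedL2 sys.pΘ fun θ => G θ i j)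
    (x : Fin NT → ℂ) :
    star x ⬝ᵥ (sys.gram G *ᵥ x) =
      ((∫ θ, (∑ r, ‖(sys.Wᴴ *ᵥ (G θ *ᵥ x)) r‖ ^ 2) * sys.pΘ θ : ℝ) : ℂ) := by
  rw [← integral_complex_ofReal]
  have e : ∀ θ, (((∑ r, ‖(sys.Wᴴ *ᵥ (G θ *ᵥ x)) r‖ ^ 2) * sys.pΘ θ : ℝ) : ℂ) =
      ∑ i, ∑ j, star (x i) * (((G θ)ᴴ * sys.W * sys.Wᴴ * G θ) i j * (sys.pΘ θ : ℂ)) * x j := by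
    intro θ
    rw [Complex.ofReal_mul, ← star_dotProduct_self_eq]
    have : star (sys.Wᴴ *ᵥ (G θ *ᵥ x)) ⬝ᵥ (sys.Wᴴ *ᵥ (G θ *ᵥ x)) =
        star x ⬝ᵥ (((G θ)ᴴ * sys.W * sys.Wᴴ * G θ) *ᵥ x) := by
      rw [Matrix.mulVec_mulVec, Matrix.star_mulVec, ← Matrix.dotProduct_mulVec,
        Matrix.mulVec_mulVec]
      simp [Matrix.conjTranspose_mul, Matrix.mul_assoc]
    rw [this]
    simp only [dotProduct, Matrix.mulVec, Finset.mul_sum, Finset.sum_mul, Pi.star_apply]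
    exact Finset.sum_congr rfl fun i _ => Finset.sum_congr rfl fun j _ => by ring
  have hi : ∀ i j, Integrable fun θ =>
      star (x i) * (((G θ)ᴴ * sys.W * sys.Wᴴ * G θ) i j * (sys.pΘ θ : ℂ)) * x j := fun i j =>
    ((h.integrable_gram hG i j).const_mul _).mul_const _
  simp only [e]
  rw [integral_finsetSum _ fun i _ => integrable_finsetSum _ fun j _ => hi i j]
  simp only [dotProduct, Matrix.mulVec, Finset.mul_sum, Pi.star_apply]
  refine Finset.sum_congr rfl fun i _ => ?_
  rw [integral_finsetSum _ fun j _ => hi i j]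
  refine Finset.sum_congr rfl fun j _ => ?_
  rw [integral_mul_const, integral_const_mul, mul_assoc]
  rfl

lemma integrable_beamformed_energy (h : sys.IsRegular)
    (hG : ∀ i j, WeightedL2 sys.pΘ fun θ => G θ i j) (x : Fin NT → ℂ) :
    Integrable fun θ => (∑ r, ‖(sys.Wᴴ *ᵥ (G θ *ᵥ x)) r‖ ^ 2) * sys.pΘ θ := by
  simp only [Finset.sum_mul]
  exact integrable_finsetSum _ fun r _ =>
    (weightedL2_beamformed hG x r).integrable_sq h.pΘ_nonneg

lemma sum_echo_sq (G : Matrix (Fin NR) (Fin NT) ℂ) :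
    ∑ p, ‖sys.echo S G p‖ ^ 2 =
      ∑ k, ∑ l, ∑ r, ‖(sys.Wᴴ *ᵥ (G *ᵥ sys.tx S k l)) r‖ ^ 2 := by
  rw [Fintype.sum_prod_type, Finset.sum_comm' (t' := Finset.univ) (s' := fun _ => Finset.univ)
    (by simp), Fintype.sum_sigma]
  exact Finset.sum_congr rfl fun k _ => Finset.sum_comm

lemma integrable_echo_energy (h : sys.IsRegular)
    (hG : ∀ i j, WeightedL2 sys.pΘ fun θ => G θ i j) :
    Integrable fun θ => (∑ p, ‖sys.echo S (G θ) p‖ ^ 2) * sys.pΘ θ := by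
  simp only [Finset.sum_mul]
  exact integrable_finsetSum _ fun p _ =>
    (weightedL2_beamformed hG _ _).integrable_sq h.pΘ_nonneg

lemma sum_vecMulVec_tx (k : Fin K) :
    ∑ l, Matrix.vecMulVec (sys.tx S k l) (star (sys.tx S k l)) = (L : ℂ) • sys.sampleCov S k := by
  rw [sampleCov, smul_smul]
  -- For `L = 0` the factor `1 / L` is 0 by convention, but the sum is empty as well.
  rcases Nat.eq_zero_or_pos L with rfl | hL
  · simp
  · rw [mul_one_div_cancel (by exact_mod_cast hL.ne'), one_smul]
    rfl

/-- Each transmitted vector contributes `xᴴ A x = tr (A x xᴴ)`, and the `x xᴴ` add up to `L` times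
the sample covariance. -/
lemma echoEnergy_eq (h : sys.IsRegular) (hG : ∀ i j, WeightedL2 sys.pΘ fun θ => G θ i j) :
    (sys.echoEnergy S G : ℂ) = L * ∑ k, (sys.gram G * sys.sampleCov S k).trace := by
  have h1 : sys.echoEnergy S G = ∑ k, ∑ l, ∫ θ,
      (∑ r, ‖(sys.Wᴴ *ᵥ (G θ *ᵥ sys.tx S k l)) r‖ ^ 2) * sys.pΘ θ := by
    have hi := fun k l => h.integrable_beamformed_energy hG (sys.tx S k l)
    simp only [echoEnergy, sum_echo_sq, Finset.sum_mul (s := (Finset.univ : Finset (Fin K))),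
      Finset.sum_mul (s := (Finset.univ : Finset (Fin L)))]
    rw [integral_finsetSum _ fun k _ => integrable_finsetSum _ fun l _ => hi k l]
    exact Finset.sum_congr rfl fun k _ => integral_finsetSum _ fun l _ => hi k l
  rw [h1]
  push_cast
  rw [Finset.mul_sum]
  refine Finset.sum_congr rfl fun k _ => ?_
  rw [← smul_eq_mul, ← Matrix.trace_smul, ← Matrix.mul_smul, ← sum_vecMulVec_tx, Matrix.mul_sum,
    Matrix.trace_sum]
  refine Finset.sum_congr rfl fun l _ => ?_
  rw [← h.gram_quadForm hG, Matrix.mul_vecMulVec, Matrix.trace_vecMulVec, dotProduct_comm]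

open scoped ComplexOrder in
lemma gram_posSemidef (h : sys.IsRegular) (hG : ∀ i j, WeightedL2 sys.pΘ fun θ => G θ i j) :
    (sys.gram G).PosSemidef := by
  refine Matrix.PosSemidef.of_dotProduct_mulVec_nonneg ?_ fun x => ?_
  · ext i j
    simp only [Matrix.conjTranspose_apply, gram, Matrix.of_apply, Complex.star_def]
    rw [← integral_conj]
    congr 1
    ext θ
    rw [map_mul, Complex.conj_ofReal]
    congr 1
    have : ((G θ)ᴴ * sys.W * sys.Wᴴ * G θ)ᴴ = (G θ)ᴴ * sys.W * sys.Wᴴ * G θ := by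
      simp [Matrix.conjTranspose_mul, Matrix.mul_assoc]
    exact congrFun₂ this i j
  · rw [h.gram_quadForm hG]
    refine Complex.zero_le_real.2 (integral_nonneg fun θ => mul_nonneg ?_ (h.pΘ_nonneg θ))
    exact Finset.sum_nonneg fun _ _ => sq_nonneg _

end IsRegular
end MIMOOFDM

/-! ### The observation information matrix and the PCRB. -/

namespace MIMOOFDM
variable {NT NR nT nR K : ℕ} {Ns : Fin K → ℕ} (sys : MIMOOFDM NT NR nT nR K Ns)
variable {L : ℕ} (S : (k : Fin K) → Matrix (Fin (Ns k)) (Fin L) ℂ)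

/-- The integrand of the observation PFIM as a function of the parameters and the noise. -/
def noiseKernel (i j : Fin 3) (x : (ℝ × ℝ × ℝ) × (Fin L × (Σ _ : Fin K, Fin nR) → ℂ)) : ℝ :=
  (2 * sys.precision * (star (sys.dMean S i x.1) ⬝ᵥ x.2).re) *
    (2 * sys.precision * (star (sys.dMean S j x.1) ⬝ᵥ x.2).re) *
    (cgPi sys.precision x.2 * sys.pZ x.1)

variable {sys}

namespace IsRegular

lemma obsIntegrand_eq (h : sys.IsRegular) (i j : Fin 3)
    (x : (ℝ × ℝ × ℝ) × (Fin L × (Σ _ : Fin K, Fin nR) → ℂ)) :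
    sys.obsIntegrand S i j x = sys.noiseKernel S i j (x.1, x.2 - sys.obsMean S x.1) := by
  rw [obsIntegrand, h.paramDeriv_log_likelihood, h.paramDeriv_log_likelihood, h.likelihood_eq]
  rfl

lemma measurable_echo {G : ℝ → Matrix (Fin NR) (Fin NT) ℂ}
    (hG : ∀ i j, Measurable fun θ => G θ i j) : Measurable fun θ => sys.echo S (G θ) := by
  refine measurable_pi_iff.2 fun p => ?_
  simp only [echo, Matrix.mulVec, dotProduct]
  exact Finset.measurable_fun_sum _ fun i _ => (Finset.measurable_fun_sum _ fun j _ =>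
    (hG i j).mul_const _).const_mul _

lemma measurable_alpha :
    Measurable fun ζ : ℝ × ℝ × ℝ => (ζ.2.1 : ℂ) + (ζ.2.2 : ℂ) * Complex.I := by
  fun_prop

lemma measurable_dMean (h : sys.IsRegular) (i : Fin 3) : Measurable (sys.dMean S i) := by
  have h1 : Measurable fun ζ : ℝ × ℝ × ℝ => sys.echo S (sys.M ζ.1) :=
    (measurable_echo S fun i j => (h.continuous_M i j).measurable).comp measurable_fst
  have h2 : Measurable fun ζ : ℝ × ℝ × ℝ => sys.echo S (sys.Mdot ζ.1) :=
    (measurable_echo S measurable_Mdot).comp measurable_fst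
  fin_cases i
  · exact measurable_alpha.smul h2
  · exact h1
  · exact h1.const_smul Complex.I

lemma measurable_obsMean (h : sys.IsRegular) : Measurable (sys.obsMean S) := by
  rw [funext (sys.obsMean_eq S)]
  exact measurable_alpha.smul
    ((measurable_echo S fun i j => (h.continuous_M i j).measurable).comp measurable_fst)

lemma measurable_re_dMean_dotProduct (h : sys.IsRegular) (i : Fin 3) :
    Measurable fun x : (ℝ × ℝ × ℝ) × (Fin L × (Σ _ : Fin K, Fin nR) → ℂ) =>
      (star (sys.dMean S i x.1) ⬝ᵥ x.2).re := by
  have hm := measurable_pi_iff.1 (h.measurable_dMean S i)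
  refine Complex.measurable_re.comp ?_
  simp only [dotProduct, Pi.star_apply]
  exact Finset.measurable_fun_sum _ fun p _ =>
    (continuous_star.measurable.comp ((hm p).comp measurable_fst)).mul
      ((measurable_pi_apply p).comp measurable_snd)

lemma integrable_dMean_energy (h : sys.IsRegular) (i : Fin 3) :
    Integrable fun ζ => (∑ p, ‖sys.dMean S i ζ p‖ ^ 2) * sys.pZ ζ := by
  have hM : Integrable fun ζ : ℝ × ℝ × ℝ =>
      ((∑ p, ‖sys.echo S (sys.M ζ.1) p‖ ^ 2) * sys.pΘ ζ.1) * sys.pα ζ.2 :=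
    (h.integrable_echo_energy S h.weightedL2_M).mul_prod h.integrable_pα
  fin_cases i
  · refine ((h.integrable_echo_energy S h.weightedL2_Mdot).mul_prod h.sq_pα).congr
      (Eventually.of_forall fun ζ => ?_)
    have : ‖(ζ.2.1 : ℂ) + (ζ.2.2 : ℂ) * Complex.I‖ ^ 2 = ζ.2.1 ^ 2 + ζ.2.2 ^ 2 := by
      rw [← Complex.normSq_eq_norm_sq, Complex.normSq_add_mul_I]
    simp only [dMean, pZ, Fin.zero_eta, Matrix.cons_val_zero, Pi.smul_apply, smul_eq_mul,
      norm_mul, mul_pow, this, ← Finset.mul_sum]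
    ring
  · refine hM.congr (Eventually.of_forall fun ζ => ?_)
    simp [dMean, pZ]; ring
  · refine hM.congr (Eventually.of_forall fun ζ => ?_)
    simp [dMean, pZ]; ring

/-- `|ab| ≤ (a² + b²) / 2` and Cauchy–Schwarz dominate the kernel by a product of a function of `ζ`
and a function of the noise, each integrable. -/
lemma integrable_noiseKernel (h : sys.IsRegular) (i j : Fin 3) :
    Integrable (sys.noiseKernel S i j) := by
  have hc := h.precision_pos
  have hg := integrable_energy_mul_cgPi (ι := Fin L × (Σ _ : Fin K, Fin nR)) hc
  have hdom := ((((h.integrable_dMean_energy S i).add (h.integrable_dMean_energy S j)).mul_prod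
    hg)).const_mul (2 * sys.precision ^ 2)
  refine hdom.mono' ?_ (Eventually.of_forall fun x => ?_)
  · refine Measurable.aestronglyMeasurable ?_
    exact (((h.measurable_re_dMean_dotProduct S i).const_mul _).mul
      ((h.measurable_re_dMean_dotProduct S j).const_mul _)).mul
      (((continuous_cgPi _).measurable.comp measurable_snd).mul
        (h.diff_pZ.continuous.measurable.comp measurable_fst))
  · have hw : 0 ≤ cgPi sys.precision x.2 * sys.pZ x.1 :=
      mul_nonneg (cgPi_nonneg hc _) (h.pZ_nonneg _)
    have hi := re_star_dotProduct_sq_le (sys.dMean S i x.1) x.2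
    have hj := re_star_dotProduct_sq_le (sys.dMean S j x.1) x.2
    set a := (star (sys.dMean S i x.1) ⬝ᵥ x.2).re
    set b := (star (sys.dMean S j x.1) ⬝ᵥ x.2).re
    have hab : |a * b| ≤ (a ^ 2 + b ^ 2) / 2 := by
      rw [abs_le]; constructor <;> nlinarith [sq_nonneg (a + b), sq_nonneg (a - b)]
    rw [Real.norm_eq_abs, noiseKernel, abs_mul, abs_of_nonneg hw]
    have e : |2 * sys.precision * a * (2 * sys.precision * b)| =
        4 * sys.precision ^ 2 * |a * b| := by
      rw [show 2 * sys.precision * a * (2 * sys.precision * b) =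
        4 * sys.precision ^ 2 * (a * b) by ring, abs_mul, abs_of_nonneg (by positivity)]
    rw [e]
    calc 4 * sys.precision ^ 2 * |a * b| * (cgPi sys.precision x.2 * sys.pZ x.1)
        ≤ 4 * sys.precision ^ 2 * (((∑ p, ‖sys.dMean S i x.1 p‖ ^ 2) * (∑ p, ‖x.2 p‖ ^ 2) +
          (∑ p, ‖sys.dMean S j x.1 p‖ ^ 2) * (∑ p, ‖x.2 p‖ ^ 2)) / 2) *
          (cgPi sys.precision x.2 * sys.pZ x.1) := by
          gcongr
          linarith
      _ = _ := by simp only [Pi.add_apply]; ring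

/-- Subtracting the mean is a shear of the product space, hence measure preserving. -/
lemma integrable_obsIntegrand (h : sys.IsRegular) (i j : Fin 3) :
    Integrable (sys.obsIntegrand S i j) := by
  have hmp : MeasurePreserving
      (fun x : (ℝ × ℝ × ℝ) × (Fin L × (Σ _ : Fin K, Fin nR) → ℂ) =>
        (x.1, x.2 - sys.obsMean S x.1)) :=
    (MeasurePreserving.id volume).skew_product
      (g := fun ζ (y : Fin L × (Σ _ : Fin K, Fin nR) → ℂ) => y - sys.obsMean S ζ)
      (measurable_snd.sub ((h.measurable_obsMean S).comp measurable_fst))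
      (Eventually.of_forall fun ζ => (measurePreserving_sub_right volume _).map_eq)
  rw [funext (h.obsIntegrand_eq S i j)]
  exact hmp.integrable_comp_of_integrable (h.integrable_noiseKernel S i j)

/-- Fubini and translation invariance leave a Gaussian covariance for each `ζ`; the constant is `4c²
/ (2c) = 2c`. -/
lemma FO_eq (h : sys.IsRegular) (i j : Fin 3) :
    sys.FO S i j = 2 * sys.precision *
      ∫ ζ, (star (sys.dMean S i ζ) ⬝ᵥ sys.dMean S j ζ).re * sys.pZ ζ := by
  have hc := h.precision_pos
  rw [FO, Matrix.of_apply, Measure.volume_eq_prod,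
    integral_prod _ (h.integrable_obsIntegrand S i j), ← integral_const_mul]
  congr 1
  ext ζ
  simp only [h.obsIntegrand_eq]
  rw [integral_sub_right_eq_self (μ := (volume : Measure (Fin L × (Σ _ : Fin K, Fin nR) → ℂ)))
    (fun n => sys.noiseKernel S i j (ζ, n)) (sys.obsMean S ζ)]
  have e : ∀ n, sys.noiseKernel S i j (ζ, n) = 4 * sys.precision ^ 2 * sys.pZ ζ *
      ((star (sys.dMean S i ζ) ⬝ᵥ n).re * (star (sys.dMean S j ζ) ⬝ᵥ n).re *
        cgPi sys.precision n) := fun n => by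
    simp only [noiseKernel]; ring
  simp only [e]
  rw [integral_const_mul, integral_re_mul_re_cgPi hc]
  field_simp
  ring

lemma FO_comm (i j : Fin 3) : sys.FO S i j = sys.FO S j i := by
  simp only [FO, Matrix.of_apply]
  refine integral_congr_ae (Eventually.of_forall fun x => ?_)
  simp only [obsIntegrand]; ring

lemma FO_gaussian_form (h : sys.IsRegular) (i j : Fin 3) :
    sys.FO S i j = 2 * ∫ ζ, (star (paramDeriv (sys.obsMean S) i ζ) ⬝ᵥ
      ((sys.obsCov L)⁻¹ *ᵥ paramDeriv (sys.obsMean S) j ζ)).re * sys.pZ ζ := by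
  rw [h.FO_eq, mul_assoc, ← integral_const_mul]
  congr 2
  ext ζ
  rw [h.obsCov_inv, Matrix.smul_mulVec, Matrix.one_mulVec, dotProduct_smul, smul_eq_mul,
    Complex.re_ofReal_mul, h.paramDeriv_obsMean, h.paramDeriv_obsMean, mul_assoc]

lemma FO_zero_zero (h : sys.IsRegular) :
    sys.FO S 0 0 = 2 * sys.precision * sys.γ * sys.echoEnergy S sys.Mdot := by
  rw [h.FO_eq, mul_assoc (2 * sys.precision), mul_comm sys.γ]
  congr 1
  refine Eq.trans ?_ (integral_prod_mul (μ := (volume : Measure ℝ))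
    (ν := (volume : Measure (ℝ × ℝ)))
    (fun θ => (∑ p, ‖sys.echo S (sys.Mdot θ) p‖ ^ 2) * sys.pΘ θ)
    (fun x => (x.1 ^ 2 + x.2 ^ 2) * sys.pα x))
  refine integral_congr_ae (Eventually.of_forall fun ζ => ?_)
  have : ‖(ζ.2.1 : ℂ) + (ζ.2.2 : ℂ) * Complex.I‖ ^ 2 = ζ.2.1 ^ 2 + ζ.2.2 ^ 2 := by
    rw [← Complex.normSq_eq_norm_sq, Complex.normSq_add_mul_I]
  simp only [star_dotProduct_self_eq, Complex.ofReal_re]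
  simp only [dMean, pZ, Matrix.cons_val_zero, Pi.smul_apply, smul_eq_mul,
    norm_mul, mul_pow, this, ← Finset.mul_sum]
  ring

/-- The two `α`-derivatives are `v` and `i v`: they have equal energy, and `Re (vᴴ (i v)) = 0`. -/
lemma FO_succ_succ (h : sys.IsRegular) (m n : Fin 2) :
    sys.FO S m.succ n.succ = 2 * sys.precision * sys.echoEnergy S sys.M *
      (1 : Matrix (Fin 2) (Fin 2) ℝ) m n := by
  have hE : ∫ ζ : ℝ × ℝ × ℝ, (∑ p, ‖sys.echo S (sys.M ζ.1) p‖ ^ 2) * sys.pZ ζ =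
      sys.echoEnergy S sys.M := by
    rw [← mul_one (sys.echoEnergy S sys.M), ← h.integral_pα]
    refine Eq.trans ?_ (integral_prod_mul (μ := (volume : Measure ℝ))
      (ν := (volume : Measure (ℝ × ℝ)))
      (fun θ => (∑ p, ‖sys.echo S (sys.M θ) p‖ ^ 2) * sys.pΘ θ) sys.pα)
    refine integral_congr_ae (Eventually.of_forall fun ζ => ?_)
    simp only [pZ]; ring
  have e : ∀ ζ, (star (sys.dMean S m.succ ζ) ⬝ᵥ sys.dMean S n.succ ζ).re * sys.pZ ζ =
      (1 : Matrix (Fin 2) (Fin 2) ℝ) m n *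
        ((∑ p, ‖sys.echo S (sys.M ζ.1) p‖ ^ 2) * sys.pZ ζ) := by
    intro ζ
    fin_cases m <;> fin_cases n <;>
      simp [dMean, star_dotProduct_self_eq, -Complex.ofReal_sum, -Complex.ofReal_pow]
  simp only [h.FO_eq, e]
  rw [integral_const_mul, hE]; ring

lemma FO_zero_succ (h : sys.IsRegular) (m : Fin 2) : sys.FO S 0 m.succ = 0 := by
  have hcross : Integrable fun θ => (star (sys.echo S (sys.Mdot θ)) ⬝ᵥ
      sys.echo S (sys.M θ)) * (sys.pΘ θ : ℂ) := by
    simp only [dotProduct, Finset.sum_mul, Pi.star_apply]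
    exact integrable_finsetSum _ fun p _ =>
      (weightedL2_beamformed h.weightedL2_Mdot _ _).integrable_conj_mul h.pΘ_nonneg
        (weightedL2_beamformed h.weightedL2_M _ _)
  have key : ∀ w : ℂ, Integrable (fun θ => (w * (star (sys.echo S (sys.Mdot θ)) ⬝ᵥ
      sys.echo S (sys.M θ))).re * sys.pΘ θ) := by
    intro w
    refine (hcross.const_mul w).re.congr (Eventually.of_forall fun θ => ?_)
    simp only [RCLike.re_to_complex]
    rw [← mul_assoc, mul_comm, Complex.re_ofReal_mul, mul_comm]
  obtain ⟨w, hw⟩ : ∃ w : ℂ, ∀ ζ, sys.dMean S m.succ ζ = w • sys.echo S (sys.M ζ.1) := by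
    fin_cases m
    · exact ⟨1, fun ζ => (one_smul _ _).symm⟩
    · exact ⟨Complex.I, fun ζ => rfl⟩
  -- `Re (ᾱ w z) = α_R Re (w z) + α_I Re (-i w z)` separates the variables, leaving the means of
  -- `α_R` and `α_I` as factors.
  have e : ∀ ζ : ℝ × ℝ × ℝ, (star (sys.dMean S 0 ζ) ⬝ᵥ sys.dMean S m.succ ζ).re * sys.pZ ζ =
      (w * (star (sys.echo S (sys.Mdot ζ.1)) ⬝ᵥ sys.echo S (sys.M ζ.1))).re * sys.pΘ ζ.1 *
        (ζ.2.1 * sys.pα ζ.2) +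
      (-Complex.I * w * (star (sys.echo S (sys.Mdot ζ.1)) ⬝ᵥ sys.echo S (sys.M ζ.1))).re *
        sys.pΘ ζ.1 * (ζ.2.2 * sys.pα ζ.2) := by
    intro ζ
    have h0 : sys.dMean S 0 ζ =
      ((ζ.2.1 : ℂ) + (ζ.2.2 : ℂ) * Complex.I) • sys.echo S (sys.Mdot ζ.1) := rfl
    rw [hw, h0, star_smul, smul_dotProduct, dotProduct_smul, smul_eq_mul, smul_eq_mul, pZ]
    generalize star (sys.echo S (sys.Mdot ζ.1)) ⬝ᵥ sys.echo S (sys.M ζ.1) = z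
    simp only [Complex.star_def, map_add, map_mul, Complex.conj_ofReal, Complex.conj_I,
      Complex.mul_re, Complex.mul_im, Complex.add_re, Complex.add_im, Complex.ofReal_re,
      Complex.ofReal_im, Complex.I_re, Complex.I_im, Complex.neg_re, Complex.neg_im]
    ring
  rw [h.FO_eq]
  simp only [e]
  have i1 := (key w).mul_prod h.integrable_re_mul_pα
  have i2 := (key (-Complex.I * w)).mul_prod h.integrable_im_mul_pα
  have z1 := integral_prod_mul (μ := (volume : Measure ℝ)) (ν := (volume : Measure (ℝ × ℝ)))
    (fun θ => (w * (star (sys.echo S (sys.Mdot θ)) ⬝ᵥ sys.echo S (sys.M θ))).re * sys.pΘ θ)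
    (fun x => x.1 * sys.pα x)
  have z2 := integral_prod_mul (μ := (volume : Measure ℝ)) (ν := (volume : Measure (ℝ × ℝ)))
    (fun θ => (-Complex.I * w * (star (sys.echo S (sys.Mdot θ)) ⬝ᵥ
      sys.echo S (sys.M θ))).re * sys.pΘ θ) (fun x => x.2 * sys.pα x)
  rw [h.mean_re, mul_zero] at z1
  rw [h.mean_im, mul_zero] at z2
  refine mul_eq_zero_of_right _ ((integral_add i1 i2).trans ?_)
  exact (congrArg₂ (· + ·) z1 z2).trans (add_zero 0)

lemma echoEnergy_nonneg (h : sys.IsRegular) (G : ℝ → Matrix (Fin NR) (Fin NT) ℂ) :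
    0 ≤ sys.echoEnergy S G :=
  integral_nonneg fun θ => mul_nonneg (Finset.sum_nonneg fun _ _ => sq_nonneg _)
    (h.pΘ_nonneg θ)

lemma γ_nonneg (h : sys.IsRegular) : 0 ≤ sys.γ :=
  integral_nonneg fun x => mul_nonneg (add_nonneg (sq_nonneg _) (sq_nonneg _)) (h.pα_nonneg x)

lemma PFIM_zero_succ (h : sys.IsRegular) (m : Fin 2) :
    sys.PFIM S 0 m.succ = 0 ∧ sys.PFIM S m.succ 0 = 0 := by
  simp [PFIM, FO_comm S m.succ 0, FP_comm m.succ 0, h.FO_zero_succ, h.FP_zero_succ]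

lemma PFIM_zero_zero (h : sys.IsRegular) : sys.PFIM S 0 0 =
    sys.priorInfoΘ + 2 * sys.precision * sys.γ * sys.echoEnergy S sys.Mdot := by
  rw [PFIM, Matrix.add_apply, h.FO_zero_zero, h.FP_zero_zero, add_comm]

lemma PFIM_zero_zero_pos (h : sys.IsRegular) : 0 < sys.PFIM S 0 0 := by
  rw [h.PFIM_zero_zero]
  have := h.priorInfoΘ_pos
  have := h.precision_pos
  have := h.γ_nonneg
  have := h.echoEnergy_nonneg S sys.Mdot
  positivity

/-- The `α`-block is the positive definite prior block plus a nonnegative multiple of the identity,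
so even `L = 0` is covered. -/
lemma isUnit_PFIM (h : sys.IsRegular) : IsUnit (sys.PFIM S) := by
  refine isUnit_of_cross_eq_zero (h.PFIM_zero_succ S 0).2 (h.PFIM_zero_succ S 1).2
    (h.PFIM_zero_zero_pos S).ne' ?_
  obtain ⟨h1, h2, hd⟩ := det_pos_of_quadForm_pos fun a b hab => h.FP_quadForm_pos hab
  have hE : 0 ≤ 2 * sys.precision * sys.echoEnergy S sys.M :=
    mul_nonneg (mul_nonneg zero_le_two h.precision_pos.le) (h.echoEnergy_nonneg S sys.M)
  have e11 : sys.FO S 1 1 = 2 * sys.precision * sys.echoEnergy S sys.M := by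
    simpa using h.FO_succ_succ S 0 0
  have e22 : sys.FO S 2 2 = 2 * sys.precision * sys.echoEnergy S sys.M := by
    simpa using h.FO_succ_succ S 1 1
  have e12 : sys.FO S 1 2 = 0 := by simpa using h.FO_succ_succ S 0 1
  have e21 : sys.FO S 2 1 = 0 := by simpa using h.FO_succ_succ S 1 0
  simp only [PFIM, Matrix.add_apply, e11, e22, e12, e21, FP_comm 2 1]
  refine ne_of_gt ?_
  nlinarith [mul_nonneg hE h1.le, mul_nonneg hE h2.le, mul_nonneg hE hE]

lemma PCRB_eq (h : sys.IsRegular) : ((sys.PCRB S : ℝ) : ℂ) =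
    1 / ((sys.priorInfoΘ : ℂ) + ((2 * nR * L * sys.γ / (NR * sys.noiseVar) : ℝ) : ℂ) *
      ∑ k, (sys.A₁ * sys.sampleCov S k).trace) := by
  have h0 := inv_zero_zero_of_cross_eq_zero (h.isUnit_PFIM S) (h.PFIM_zero_succ S 0).2
    (h.PFIM_zero_succ S 1).2
  rw [PCRB, h0, h.PFIM_zero_zero, Complex.ofReal_div, Complex.ofReal_one, Complex.ofReal_add,
    Complex.ofReal_mul _ (sys.echoEnergy S sys.Mdot), h.echoEnergy_eq S h.weightedL2_Mdot,
    h.precision_eq, ← mul_assoc]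
  congr 3
  push_cast
  ring

end IsRegular
end MIMOOFDM

/-! ### The strong law for empirical covariances and the limit of the ratio. -/

section LawOfLargeNumbers
variable {ι : Type*} [Fintype ι]

lemma measurable_ofReal_cgPi (c : ℝ) :
    Measurable fun y : ι → ℂ => ENNReal.ofReal (cgPi c y) :=
  ENNReal.measurable_ofReal.comp (continuous_cgPi c).measurable

variable [DecidableEq ι]

lemma cnMeasure_zero_one :
    cnMeasure (0 : ι → ℂ) 1 = volume.withDensity fun y => ENNReal.ofReal (cgPi 1 y) := by
  have h : (1 : Matrix ι ι ℂ) = ((1 : ℝ) : ℂ) • 1 := by simp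
  unfold cnMeasure
  rw [h]
  simp only [cnPDF_smul_one one_pos, sub_zero, inv_one]

lemma integrable_mul_conj_cnMeasure (i j : ι) :
    Integrable (fun y : ι → ℂ => y i * star (y j)) (cnMeasure 0 1) := by
  rw [cnMeasure_zero_one, integrable_withDensity_iff_integrable_smul' (measurable_ofReal_cgPi 1)
    (Eventually.of_forall fun _ => ENNReal.ofReal_lt_top)]
  simpa only [ENNReal.toReal_ofReal (cgPi_nonneg one_pos _), Complex.real_smul] using
    integrable_cgPi_mul_conj one_pos i j

/-- The covariance matrix of `CN(0, I)`. -/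
lemma integral_mul_conj_cnMeasure (i j : ι) :
    ∫ y : ι → ℂ, y i * star (y j) ∂(cnMeasure 0 1) = (1 : Matrix ι ι ℂ) i j := by
  rw [cnMeasure_zero_one, integral_withDensity_eq_integral_toReal_smul (measurable_ofReal_cgPi 1)
    (Eventually.of_forall fun _ => ENNReal.ofReal_lt_top)]
  simp only [ENNReal.toReal_ofReal (cgPi_nonneg one_pos _), Complex.real_smul]
  rw [integral_cgPi_mul_conj one_pos, Matrix.one_apply]
  simp

/-- The empirical covariance matrix of independent `CN(0, I)` vectors converges almost surely. -/
lemma tendsto_empirical_covariance {Ω : Type*} [MeasurableSpace Ω] {P : Measure Ω}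
    [IsProbabilityMeasure P] {s : ℕ → Ω → ι → ℂ} (hlaw : ∀ l, HasLaw (s l) (cnMeasure 0 1) P)
    (hind : iIndepFun s P) :
    ∀ᵐ ω ∂P, Tendsto (fun L : ℕ => (1 / (L : ℂ)) • ∑ l : Fin L,
      Matrix.vecMulVec (s l ω) (star (s l ω))) atTop (𝓝 1) := by
  have hentry : ∀ i j : ι, ∀ᵐ ω ∂P, Tendsto (fun L : ℕ => (L : ℝ)⁻¹ •
      ∑ l ∈ Finset.range L, s l ω i * star (s l ω j)) atTop (𝓝 ((1 : Matrix ι ι ℂ) i j)) := by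
    intro i j
    have hφ : Measurable fun y : ι → ℂ => y i * star (y j) :=
      ((continuous_apply i).mul (continuous_apply j).star).measurable
    have hint : Integrable (fun ω => s 0 ω i * star (s 0 ω j)) P := by
      have := integrable_mul_conj_cnMeasure i j
      rw [← (hlaw 0).map_eq] at this
      exact this.comp_aemeasurable (hlaw 0).aemeasurable
    have h := strong_law_ae (μ := P) (fun l ω => s l ω i * star (s l ω j)) hint
      (fun l m hlm => (hind.indepFun hlm).comp hφ hφ)
      (fun l => ((hlaw l).identDistrib (hlaw 0)).comp hφ)
    have hmean : ∫ ω, s 0 ω i * star (s 0 ω j) ∂P = (1 : Matrix ι ι ℂ) i j := by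
      rw [← integral_mul_conj_cnMeasure i j,
        ← (hlaw 0).integral_comp hφ.aestronglyMeasurable]
      rfl
    rwa [hmean] at h
  have hall := ae_all_iff.2 fun i => ae_all_iff.2 (hentry i)
  filter_upwards [hall] with ω hω
  refine tendsto_pi_nhds.2 fun i => tendsto_pi_nhds.2 fun j => (hω i j).congr fun L => ?_
  rw [Matrix.smul_apply, Matrix.sum_apply, ← Fin.sum_univ_eq_sum_range
    (fun l => s l ω i * star (s l ω j)), Complex.real_smul]
  simp [Matrix.vecMulVec_apply]

end LawOfLargeNumbers

/-- The ratio of the reciprocals of two affine functions of `L` with asymptotically equal slopes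
tends to `1`. -/
lemma tendsto_ratio_one {p κ t : ℂ} {u : ℕ → ℂ} (hp : p ≠ 0) (hu : Tendsto u atTop (𝓝 t))
    (h0 : t = 0 → ∀ L, u L = 0) :
    Tendsto (fun L : ℕ => 1 / (p + L * κ * u L) / (1 / (p + L * κ * t))) atTop (𝓝 1) := by
  by_cases hκt : κ * t = 0
  -- With zero limiting slope, `u → t` says nothing about `L * u L`. The hypothesis `h0` makes the
  -- slope exactly 0 at every `L`.
  · have : ∀ L : ℕ, 1 / (p + L * κ * u L) / (1 / (p + L * κ * t)) = 1 := by
      intro L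
      have h1 : κ * u L = 0 := by
        rcases mul_eq_zero.1 hκt with h | h
        · rw [h, zero_mul]
        · rw [h0 h L, mul_zero]
      rw [mul_assoc, mul_assoc, h1, hκt, mul_zero, add_zero, div_self (one_div_ne_zero hp)]
    simp only [this, tendsto_const_nhds]
  · have hpL : Tendsto (fun L : ℕ => p / (L : ℂ)) atTop (𝓝 0) :=
      tendsto_const_div_atTop_nhds_zero_nat p
    have hnum := hpL.add (tendsto_const_nhds (x := κ * t))
    have hden := hpL.add (hu.const_mul κ)
    rw [zero_add] at hnum hden
    have h := hnum.div hden hκt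
    rw [div_self hκt] at h
    refine h.congr' ?_
    filter_upwards [eventually_ge_atTop 1] with L hL
    have hL' : (L : ℂ) ≠ 0 := by exact_mod_cast (Nat.pos_of_ne_zero (by omega)).ne'
    have e : ∀ v : ℂ, p + L * κ * v = (p / L + κ * v) * L := fun v => by field_simp
    simp only [Pi.div_apply]
    rw [e, e, div_div_eq_mul_div, div_one, one_div_mul_eq_div, mul_div_mul_right _ _ hL']

/-! ### Sample covariances against transmit covariances. -/

namespace MIMOOFDM
variable {NT NR nT nR K : ℕ} {Ns : Fin K → ℕ} {sys : MIMOOFDM NT NR nT nR K Ns}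

lemma sampleCov_eq {L : ℕ} (S : (k : Fin K) → Matrix (Fin (Ns k)) (Fin L) ℂ) (k : Fin K) :
    sys.sampleCov S k = (sys.VRF * sys.VBB k) * ((1 / (L : ℂ)) • ∑ l : Fin L,
      Matrix.vecMulVec (fun i => S k i l) (star fun i => S k i l)) *
      (sys.VRF * sys.VBB k)ᴴ := by
  rw [sampleCov, Matrix.mul_smul, Matrix.smul_mul, Matrix.mul_sum, Matrix.sum_mul]
  congr 1
  refine Finset.sum_congr rfl fun l _ => ?_
  rw [Matrix.mul_vecMulVec, Matrix.vecMulVec_mul, Matrix.star_mulVec]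

lemma txCov_eq (k : Fin K) :
    sys.txCov k = (sys.VRF * sys.VBB k) * (sys.VRF * sys.VBB k)ᴴ := by
  simp only [txCov, RBB, Matrix.conjTranspose_mul, Matrix.mul_assoc]

lemma trace_A₁_mul_txCov (k : Fin K) :
    (sys.A₁ * sys.VRF * sys.RBB k * sys.VRFᴴ).trace = (sys.A₁ * sys.txCov k).trace := by
  simp only [txCov, Matrix.mul_assoc]

lemma trace_A₂_mul_txCov (k : Fin K) :
    (sys.A₂ * sys.VRF * sys.RBB k * sys.VRFᴴ).trace = (sys.A₂ * sys.txCov k).trace := by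
  simp only [txCov, Matrix.mul_assoc]

namespace IsRegular

open scoped ComplexOrder in
/-- If the transmit covariances carry no information on the angle, no data symbols do. -/
lemma trace_sampleCov_eq_zero (h : sys.IsRegular)
    (h0 : ∑ k, (sys.A₁ * sys.txCov k).trace = 0)
    {L : ℕ} (S : (k : Fin K) → Matrix (Fin (Ns k)) (Fin L) ℂ) :
    ∑ k, (sys.A₁ * sys.sampleCov S k).trace = 0 := by
  -- With `B = V_RF V_BB,k`, each `Bᴴ A₁ B` is positive semidefinite. Nonnegative traces summing to
  -- 0 all vanish, so each matrix is 0, whatever empirical covariance multiplies it.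
  have hA : sys.A₁.PosSemidef := h.gram_posSemidef h.weightedL2_Mdot
  have hpsd := fun k => hA.conjTranspose_mul_mul_same (sys.VRF * sys.VBB k)
  have htr : ∀ k, (sys.A₁ * sys.txCov k).trace =
      ((sys.VRF * sys.VBB k)ᴴ * sys.A₁ * (sys.VRF * sys.VBB k)).trace := fun k => by
    rw [txCov_eq, ← Matrix.mul_assoc, Matrix.trace_mul_comm, ← Matrix.mul_assoc]
  simp only [htr] at h0
  rw [Finset.sum_eq_zero_iff_of_nonneg fun k _ => (hpsd k).trace_nonneg] at h0
  refine Finset.sum_eq_zero fun k hk => ?_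
  rw [sampleCov_eq, ← Matrix.mul_assoc, Matrix.trace_mul_comm, ← Matrix.mul_assoc,
    ← Matrix.mul_assoc, (hpsd k).trace_eq_zero_iff.1 (h0 k hk), Matrix.zero_mul,
    Matrix.trace_zero]

/-- Each trace is a continuous function of the empirical symbol covariance, and its value at the
identity involves `txCov`. -/
lemma tendsto_sum_trace_sampleCov {s : (k : Fin K) → ℕ → Fin (Ns k) → ℂ}
    (hs : ∀ k, Tendsto (fun L : ℕ => (1 / (L : ℂ)) • ∑ l : Fin L,
      Matrix.vecMulVec (s k l) (star (s k l))) atTop (𝓝 1)) :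
    Tendsto (fun L : ℕ => ∑ k, (sys.A₁ * sys.sampleCov (symbolBlock s L) k).trace) atTop
      (𝓝 (∑ k, (sys.A₁ * sys.txCov k).trace)) := by
  refine tendsto_finsetSum _ fun k _ => ?_
  have hc : Continuous fun R : Matrix (Fin (Ns k)) (Fin (Ns k)) ℂ =>
      (sys.A₁ * ((sys.VRF * sys.VBB k) * R * (sys.VRF * sys.VBB k)ᴴ)).trace := by fun_prop
  have := (hc.tendsto 1).comp (hs k)
  rw [Matrix.mul_one, ← txCov_eq] at this
  refine this.congr fun L => ?_
  rw [sampleCov_eq]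
  rfl

end IsRegular
end MIMOOFDM

end

theorem mainTheorem6 {NT NR nT nR K : ℕ} {Ns : Fin K → ℕ}
    (sys : MIMOOFDM NT NR nT nR K Ns)
    -- the array: the number of RF chains divides the number of antennas, partial connection
    (hNR : 0 < NR) (hdiv : nR ∣ NR) (hW : IsPartiallyConnected sys.W)
    (hσ : 0 < sys.noiseVar)
    (ha : Differentiable ℝ sys.a) (hb : Differentiable ℝ sys.b)
    -- the prior of the angle is a differentiable density with finite Fisher information
    (hΘ_nonneg : ∀ θ, 0 ≤ sys.pΘ θ) (hΘ_one : ∫ θ, sys.pΘ θ = 1)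
    (hΘ_diff : Differentiable ℝ sys.pΘ)
    (hΘ_info : Integrable fun θ => (deriv (fun t => Real.log (sys.pΘ t)) θ) ^ 2 * sys.pΘ θ)
    -- the prior of the reflection coefficient likewise, with zero mean and finite power
    (hα_nonneg : ∀ x, 0 ≤ sys.pα x) (hα_one : ∫ x, sys.pα x = 1)
    (hα_diff : Differentiable ℝ sys.pα)
    (hα_info : ∀ m : Fin 2, Integrable fun x =>
      (lineDeriv ℝ (fun x' => Real.log (sys.pα x')) x (alphaDir m)) ^ 2 * sys.pα x)
    (hα_sq : Integrable fun x : ℝ × ℝ => (x.1 ^ 2 + x.2 ^ 2) * sys.pα x)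
    (hα_re : ∫ x : ℝ × ℝ, x.1 * sys.pα x = 0) (hα_im : ∫ x : ℝ × ℝ, x.2 * sys.pα x = 0)
    -- the matrices `A₁` and `A₂` exist
    (hM : ∀ i j, Integrable fun θ => ‖sys.M θ i j‖ ^ 2 * sys.pΘ θ)
    (hMdot : ∀ i j, Integrable fun θ => ‖sys.Mdot θ i j‖ ^ 2 * sys.pΘ θ) :
    -- for all data symbols: the PFIMs exist, `F_O` has the Gaussian form, the cross term
    -- vanishes, and `F` is invertible
    (∀ (L : ℕ) (S : (k : Fin K) → Matrix (Fin (Ns k)) (Fin L) ℂ),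
      (∀ i j, Integrable (sys.obsIntegrand S i j)) ∧
      (∀ i j, Integrable (sys.priorIntegrand i j)) ∧
      (∀ i j, sys.FO S i j = 2 * ∫ ζ,
        (star (paramDeriv (sys.obsMean S) i ζ) ⬝ᵥ
          ((sys.obsCov L)⁻¹ *ᵥ paramDeriv (sys.obsMean S) j ζ)).re * sys.pZ ζ) ∧
      (∀ m : Fin 2, sys.FO S 0 m.succ = 0 ∧ sys.FO S m.succ 0 = 0) ∧
      IsUnit (sys.PFIM S)) ∧
    -- data symbols whose sample covariances are the transmit covariances: the closed forms
    (∀ (L : ℕ) (S : (k : Fin K) → Matrix (Fin (Ns k)) (Fin L) ℂ),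
      (∀ k, sys.sampleCov S k = sys.txCov k) →
      ((sys.FO S 0 0 : ℝ) : ℂ) =
        ((2 * nR * L * sys.γ / (NR * sys.noiseVar) : ℝ) : ℂ) *
          ∑ k, (sys.A₁ * sys.VRF * sys.RBB k * sys.VRFᴴ).trace ∧
      (∀ m n : Fin 2, ((sys.FO S m.succ n.succ : ℝ) : ℂ) =
        ((2 * nR * L / (NR * sys.noiseVar) : ℝ) : ℂ) *
          (∑ k, (sys.A₂ * sys.VRF * sys.RBB k * sys.VRFᴴ).trace) *
            (1 : Matrix (Fin 2) (Fin 2) ℂ) m n) ∧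
      ((sys.PCRB S : ℝ) : ℂ) =
        1 / ((sys.priorInfoΘ : ℂ) +
          ((2 * nR * L * sys.γ / (NR * sys.noiseVar) : ℝ) : ℂ) *
            ∑ k, (sys.A₁ * sys.VRF * sys.RBB k * sys.VRFᴴ).trace)) ∧
    -- random data symbols: the closed form is almost surely asymptotically exact
    (∀ (Ω : Type*) [MeasurableSpace Ω] (P : Measure Ω) [IsProbabilityMeasure P]
      (s : (k : Fin K) → ℕ → Ω → Fin (Ns k) → ℂ),
      (∀ k l, HasLaw (s k l) (cnMeasure 0 1) P) →
      (∀ k, iIndepFun (s k) P) →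
      ∀ᵐ ω ∂P, Tendsto
        (fun L : ℕ =>
          ((sys.PCRB (MIMOOFDM.symbolBlock (fun k l => s k l ω) L) : ℝ) : ℂ) /
            (1 / ((sys.priorInfoΘ : ℂ) +
              ((2 * nR * L * sys.γ / (NR * sys.noiseVar) : ℝ) : ℂ) *
                ∑ k, (sys.A₁ * sys.VRF * sys.RBB k * sys.VRFᴴ).trace)))
        atTop (𝓝 1)) := by
  have h : sys.IsRegular := ⟨hNR, hdiv, hW, hσ, ha, hb, hΘ_nonneg, hΘ_one, hΘ_diff, hΘ_info,
    hα_nonneg, hα_one, hα_diff, hα_info, hα_sq, hα_re, hα_im, hM, hMdot⟩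
  refine ⟨fun L S => ⟨h.integrable_obsIntegrand S, h.integrable_priorIntegrand,
    h.FO_gaussian_form S, fun m => ⟨h.FO_zero_succ S m, ?_⟩, h.isUnit_PFIM S⟩,
    fun L S hS => ⟨?_, fun m n => ?_, ?_⟩, fun Ω _ P _ s hlaw hind => ?_⟩
  · rw [MIMOOFDM.IsRegular.FO_comm, h.FO_zero_succ]
  · rw [h.FO_zero_zero, Complex.ofReal_mul, h.echoEnergy_eq S h.weightedL2_Mdot, h.precision_eq]
    simp only [MIMOOFDM.trace_A₁_mul_txCov, hS]
    rw [← mul_assoc]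
    congr 1
    push_cast
    ring
  · have h1 : (((1 : Matrix (Fin 2) (Fin 2) ℝ) m n : ℝ) : ℂ) =
        (1 : Matrix (Fin 2) (Fin 2) ℂ) m n := by
      simp only [Matrix.one_apply]; split_ifs <;> simp
    rw [h.FO_succ_succ, Complex.ofReal_mul, Complex.ofReal_mul, h1,
      h.echoEnergy_eq S h.weightedL2_M, h.precision_eq]
    simp only [MIMOOFDM.trace_A₂_mul_txCov, hS]
    rw [← mul_assoc]
    congr 2
    push_cast
    ring
  · rw [h.PCRB_eq]
    simp only [MIMOOFDM.trace_A₁_mul_txCov, hS]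
  · filter_upwards [ae_all_iff.2 fun k => tendsto_empirical_covariance (hlaw k) (hind k)]
      with ω hω
    -- Isolating the factor `L` puts both PCRB expressions into the affine form of
    -- `tendsto_ratio_one`.
    have hκ : ∀ L : ℕ, ((2 * nR * L * sys.γ / (NR * sys.noiseVar) : ℝ) : ℂ) =
        (L : ℂ) * ((2 * nR * sys.γ / (NR * sys.noiseVar) : ℝ) : ℂ) := fun L => by
      push_cast; ring
    simp only [h.PCRB_eq, MIMOOFDM.trace_A₁_mul_txCov, hκ]
    exact tendsto_ratio_one (Complex.ofReal_ne_zero.2 h.priorInfoΘ_pos.ne')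
      (MIMOOFDM.IsRegular.tendsto_sum_trace_sampleCov (s := fun k l => s k l ω) hω)
      fun h0 L => h.trace_sampleCov_eq_zero h0 _
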